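/- Let $\ell^2_\infty$ denote $\mathbb{R}^2$ with the norm $\|a\|=\max\{|a_1|,|a_2|\}$. There is an absolute constant $\gamma>0$ with the following property. Let $(\mathcal{M},\rho)$ be a pseudometric space, where $\rho:\mathcal{M}\times\mathcal{M}\to[0,+\infty]$ is symmetric, vanishes on the diagonal and satisfies the triangle inequality (the values $\rho(x,y)=0$ for $x\ne y$ and $\rho(x,y)=+\infty$ are allowed). Let $F$ assign to each $x\in\mathcal{M}$ a non-empty compact convex set $F(x)\subset\mathbb{R}^2$. For each $x\in\mathcal{M}$ fix a family $\mathcal{H}(x)$ of closed half-planes in $\mathbb{R}^2$ such that $$F(x)=\bigcap\{H: H\in\mathcal{H}(x)\}.$$ A Lipschitz selection of $F$ is a Lipschitz mapping $f:\mathcal{M}\to\ell^2_\infty$ with $f(x)\in F(x)$ for all $x\in\mathcal{M}$. Let $|F|$ denote the infimum over all Lipschitz selections $f$ of $F$ of the seminorm $\inf\{K>0:\|f(x)-f(y)\|\le K\rho(x,y)\ \text{for all } x,y\in\mathcal{M}\}$. Then $F$ has a Lipschitz selection if and only if there is a constant $\lambda>0$ such that for all $x,x',y,y'\in\mathcal{M}$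 (not necessarily distinct) and all half-planes $G_x\in\mathcal{H}(x)$, $G_{x'}\in\mathcal{H}(x')$, $G_y\in\mathcal{H}(y)$, $G_{y'}\in\mathcal{H}(y')$ (chosen independently, even where points coincide), $$\operatorname{dist}(G_x\cap G_{x'},\,G_y\cap G_{y'})\le\lambda\left\{\frac{\rho(x,x')}{\sin\varphi(G_x,G_{x'})}+\frac{\rho(y,y')}{\sin\varphi(G_y,G_{y'})}+\operatorname{diam}_\rho\{x,x',y,y'\}\right\}.\qquad(*)$$ Here $\varphi(G,G')\in[0,\pi/2]$ is the angle between the boundary lines of $G$ and $G'$ (equal to $0$ if they are parallel); $\operatorname{dist}(A,B)=\inf\{\|a-b\|:a\in A,\,b\in B\}$, with $\operatorname{dist}(A,B)=0$ if $A$ or $B$ is empty; $\operatorname{diam}_\rho$ is the diameter with respect to $\rho$; and $\tfrac00=0$, $\tfrac a0=+\infty$ for $a>0$. Moreover, $$\tfrac{1}{\sqrt2}\,\inf\lambda\le|F|\le\gamma\,\inf\lambda,$$ where $\inf\lambda$ is the infimum of all $\lambda>0$ for which $(*)$ holds for all these choices (with $\inf\emptyset=+\infty$). -/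

import Mathlib

open scoped ENNReal NNReal

noncomputable section

namespace LipSel

/-- The space `ℓ^2_∞`: in Mathlib `Fin 2 → ℝ` carries the uniform norm `max |x₁| |x₂|`. -/
abbrev Plane : Type := Fin 2 → ℝ

/-- A closed half-plane `H(n, α) = {a : ⟨a, n⟩ + α ≤ 0}` of the plane, recorded by its Euclidean
unit outer normal `n` and its offset `α` (both are determined by the half-plane as a set). -/
structure HalfPlane where
  normal : Plane
  offset : ℝ
  unit_normal : normal 0 ^ 2 + normal 1 ^ 2 = 1

namespace HalfPlane

/-- The half-plane as a set of points. -/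
def carrier (G : HalfPlane) : Set Plane := {a | a ⬝ᵥ G.normal + G.offset ≤ 0}

/-- The directional vector of the boundary line `{a : ⟨a, n⟩ + α = 0}`, in the Euclidean plane. -/
def direction (G : HalfPlane) : EuclideanSpace ℝ (Fin 2) := !₂[-G.normal 1, G.normal 0]

/-- The angle between the boundary lines of two half-planes: the smaller of the two angles that
the lines form. It lies in `[0, π/2]` and is `0` for parallel lines. -/
def boundaryAngle (G G' : HalfPlane) : ℝ :=
  min (InnerProductGeometry.angle G.direction G'.direction)
    (Real.pi - InnerProductGeometry.angle G.direction G'.direction)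

end HalfPlane

open Classical in
/-- The distance between two sets of the plane (in the uniform norm), with the convention that
the distance is `0` if one of the sets is empty. -/
def setDist (A B : Set Plane) : ℝ≥0∞ :=
  if A.Nonempty ∧ B.Nonempty then ⨅ a ∈ A, ⨅ b ∈ B, edist a b else 0

variable {M : Type*} [PseudoEMetricSpace M]

/-- The Lipschitz seminorm: the infimum of all `K > 0` with `‖f x - f y‖ ≤ K ρ(x, y)` for all
`x, y` (`∞` if there is no such `K`). -/
def lipSeminorm (f : M → Plane) : ℝ≥0∞ :=
  ⨅ (K : ℝ≥0) (_ : 0 < K) (_ : LipschitzWith K f), (K : ℝ≥0∞)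

/-- `f` is a Lipschitz selection of the set-valued mapping `F`. -/
def IsLipschitzSelection (F : M → ConvexBody Plane) (f : M → Plane) : Prop :=
  (∀ x, f x ∈ (F x : Set Plane)) ∧ ∃ K : ℝ≥0, LipschitzWith K f

/-- `|F|`, the infimum of the Lipschitz seminorms of all Lipschitz selections of `F`
(`∞` if there are none). -/
def selectionNorm (F : M → ConvexBody Plane) : ℝ≥0∞ :=
  ⨅ (f : M → Plane) (_ : IsLipschitzSelection F f), lipSeminorm f

/-- The coordinate-free inequality with constant `l`, for all four points and all choices of four
half-planes from the families attached to them. Division in `ℝ≥0∞` satisfies `0 / 0 = 0` and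
`a / 0 = ∞` for `a > 0`. -/
def CoordinateFreeCriterion (Hc : M → Set HalfPlane) (l : ℝ≥0) : Prop :=
  ∀ x x' y y' : M, ∀ Gx ∈ Hc x, ∀ Gx' ∈ Hc x', ∀ Gy ∈ Hc y, ∀ Gy' ∈ Hc y',
    setDist (Gx.carrier ∩ Gx'.carrier) (Gy.carrier ∩ Gy'.carrier) ≤
      (l : ℝ≥0∞) *
        (edist x x' / ENNReal.ofReal (Real.sin (Gx.boundaryAngle Gx')) +
          edist y y' / ENNReal.ofReal (Real.sin (Gy.boundaryAngle Gy')) +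
          Metric.ediam {x, x', y, y'})

/-- The infimum of all constants `l > 0` for which the criterion holds (`∞` if there are none). -/
def criterionConst (Hc : M → Set HalfPlane) : ℝ≥0∞ :=
  ⨅ (l : ℝ≥0) (_ : 0 < l) (_ : CoordinateFreeCriterion Hc l), (l : ℝ≥0∞)

end LipSel

end

/-! Sufficiency. Let the criterion hold with constant `l`, put k = 48`l`, and let the refinement
R(x) consist of the points within kρ(x,y) of every half-plane attached to any y at finite distance
from x. By Helly and Farkas, emptiness of R(x) would be certified by a positive relation between
three normals. The criterion, applied to pairs among the three half-planes, excludes this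
(`offset_sum_le`).

The projections of R(x) and R(y) to any direction e come within O(kρ(x,y)) of each other
(`inner_le_inner_add`). By duality, a gap between them is certified by multipliers on two
half-planes constraining R(x) and two constraining R(y). The criterion controls the gap only if each
multiplier times the sine of the angle of its pair is bounded below. In general, `gap_le` tilts e:
multipliers and gap vary affinely, so it suffices to bound the gap at tilts on both sides of e. If a
multiplier soon vanishes, nonemptiness of the refinements bounds the gap there; if all stay
nonnegative over a long range of tilts, the criterion applies in the middle of that range.

Hence the two coordinate projections of R(x), which are intervals, have Lipschitz selections.
Together they give g with g(x) in the rectangular hull of R(x). Let f(x) be a point of R(x) nearest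
to g(x) in the uniform norm. It is a corner of a square centred at g(x), so it is determined by
g(x), the distance and two signs; `dist_nearest_le` shows that the signs agree for x and y unless
both distances are O(kρ(x,y)). So f is Lipschitz with constant 1440`l`.

Necessity. Given a selection f with constant K, slide f(x) along the boundary direction of the first
half-plane until it enters the second. The cost is at most √2 K ρ(x,x') divided by the sine of the
angle. -/

noncomputable section

namespace LipSel

/-! ### Helly's theorem and Farkas' lemma for half-planes. -/

/-- The half-plane `{a | ⟨a, n⟩ ≤ β}`. -/
def halfSpace (n : Plane) (β : ℝ) : Set Plane := {a | a 0 * n 0 + a 1 * n 1 ≤ β}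

theorem mem_halfSpace {n : Plane} {β : ℝ} {a : Plane} :
    a ∈ halfSpace n β ↔ a 0 * n 0 + a 1 * n 1 ≤ β := Iff.rfl

theorem convex_halfSpace (n : Plane) (β : ℝ) : Convex ℝ (halfSpace n β) := by
  intro a ha b hb s t hs ht hst
  simp only [mem_halfSpace, Pi.add_apply, Pi.smul_apply, smul_eq_mul] at *
  have h1 := mul_le_mul_of_nonneg_left ha hs
  have h2 := mul_le_mul_of_nonneg_left hb ht
  have h3 : s * β + t * β = β := by rw [← add_mul, hst, one_mul]
  nlinarith

theorem isClosed_halfSpace (n : Plane) (β : ℝ) : IsClosed (halfSpace n β) :=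
  isClosed_le (by fun_prop) continuous_const

/-- Helly's theorem for finitely many half-planes. -/
theorem finite_halfSpace_inter {ι : Type*} (n : ι → Plane) (β : ι → ℝ)
    (h3 : ∀ i j k, ∃ a, a ∈ halfSpace (n i) (β i) ∧ a ∈ halfSpace (n j) (β j) ∧
      a ∈ halfSpace (n k) (β k)) (s : Finset ι) :
    (⋂ i ∈ s, halfSpace (n i) (β i)).Nonempty := by
  classical
  apply Convex.helly_theorem' (𝕜 := ℝ) (fun i _ => convex_halfSpace _ _)
  intro I _ hI
  have hf : Module.finrank ℝ Plane = 2 := by simp [Plane]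
  rw [hf] at hI
  have : I.card = 0 ∨ I.card = 1 ∨ I.card = 2 ∨ I.card = 3 := by omega
  rcases this with h | h | h | h
  · rw [Finset.card_eq_zero] at h
    subst h
    simp
  · obtain ⟨i, rfl⟩ := Finset.card_eq_one.1 h
    obtain ⟨a, ha, -, -⟩ := h3 i i i
    exact ⟨a, by simpa using ha⟩
  · obtain ⟨i, j, -, rfl⟩ := Finset.card_eq_two.1 h
    obtain ⟨a, ha, hb, -⟩ := h3 i j j
    exact ⟨a, by simpa using ⟨ha, hb⟩⟩
  · obtain ⟨i, j, k, -, -, -, rfl⟩ := Finset.card_eq_three.1 h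
    obtain ⟨a, ha, hb, hc⟩ := h3 i j k
    exact ⟨a, by simpa using ⟨ha, hb, hc⟩⟩

/-- If an intersection of half-planes is nonempty and bounded, then some finite subfamily has a
bounded intersection. -/
theorem exists_finite_subfamily_isCompact {ι : Type*} (n : ι → Plane) (β : ι → ℝ) (J : Set ι)
    (hne : (⋂ i ∈ J, halfSpace (n i) (β i)).Nonempty)
    (hbd : Bornology.IsBounded (⋂ i ∈ J, halfSpace (n i) (β i))) :
    ∃ u : Finset ι, IsCompact (⋂ i ∈ u, halfSpace (n i) (β i)) := by
  classical
  obtain ⟨p, hp⟩ := hne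
  obtain ⟨R, hR⟩ := hbd.subset_ball p
  have hR0 : 0 < R := by simpa using hR hp
  have hS : IsCompact (Metric.sphere p R) := isCompact_sphere p R
  obtain ⟨u, hu⟩ := hS.elim_finite_subfamily_closed
    (fun i : J => halfSpace (n i) (β i)) (fun i => isClosed_halfSpace _ _) (by
      rw [← Set.disjoint_iff_inter_eq_empty, Set.disjoint_left]
      intro a ha ha'
      have : a ∈ ⋂ i ∈ J, halfSpace (n i) (β i) := by
        simp only [Set.mem_iInter, Subtype.forall] at ha' ⊢
        exact ha'
      have h1 := hR this
      rw [Metric.mem_ball] at h1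
      rw [Metric.mem_sphere] at ha
      linarith)
  -- Finitely many half-planes already miss the sphere. Their intersection is convex and contains
  -- the centre `p`, so a point outside the ball would give a segment crossing the sphere.
  refine ⟨u.image Subtype.val, ?_⟩
  have hK : IsClosed (⋂ i ∈ u.image Subtype.val, halfSpace (n i) (β i)) :=
    isClosed_biInter fun i _ => isClosed_halfSpace _ _
  refine (isCompact_closedBall p R).of_isClosed_subset hK ?_
  intro q hq
  rw [Metric.mem_closedBall]
  by_contra! hlt
  have hconv : Convex ℝ (⋂ i ∈ u.image Subtype.val, halfSpace (n i) (β i)) :=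
    convex_iInter₂ fun i _ => convex_halfSpace _ _
  have hpK : p ∈ ⋂ i ∈ u.image Subtype.val, halfSpace (n i) (β i) := by
    simp only [Set.mem_iInter] at hp ⊢
    intro i hi
    obtain ⟨j, _, rfl⟩ := Finset.mem_image.1 hi
    exact hp j.1 j.2
  have hd : 0 < dist q p := hR0.trans hlt
  have ht : R / dist q p ∈ Set.Icc (0:ℝ) 1 :=
    ⟨by positivity, (div_le_one hd).2 hlt.le⟩
  have hz := hconv.add_smul_sub_mem hpK hq ht
  have : p + (R / dist q p) • (q - p) ∈
      Metric.sphere p R ∩ ⋂ i ∈ u, halfSpace (n i.1) (β i.1) := by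
    constructor
    · rw [Metric.mem_sphere, dist_eq_norm, add_sub_cancel_left, norm_smul, ← dist_eq_norm,
        Real.norm_of_nonneg ht.1, div_mul_cancel₀ _ hd.ne']
    · simp only [Set.mem_iInter] at hz ⊢
      intro i hi
      exact hz i.1 (Finset.mem_image_of_mem _ hi)
  rw [hu] at this
  exact this

/-- Helly's theorem for an infinite family of half-planes, some subfamily of which has a nonempty
bounded intersection. -/
theorem halfSpace_inter_nonempty {ι : Type*} (n : ι → Plane) (β : ι → ℝ) (J : Set ι)
    (hne : (⋂ i ∈ J, halfSpace (n i) (β i)).Nonempty)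
    (hbd : Bornology.IsBounded (⋂ i ∈ J, halfSpace (n i) (β i)))
    (h3 : ∀ i j k, ∃ a, a ∈ halfSpace (n i) (β i) ∧ a ∈ halfSpace (n j) (β j) ∧
      a ∈ halfSpace (n k) (β k)) :
    ∃ a, ∀ i, a ∈ halfSpace (n i) (β i) := by
  classical
  obtain ⟨u, hu⟩ := exists_finite_subfamily_isCompact n β J hne hbd
  obtain ⟨a, -, ha⟩ := hu.inter_iInter_nonempty (fun i => halfSpace (n i) (β i))
    (fun i => isClosed_halfSpace _ _) (fun v => by
      obtain ⟨a, ha⟩ := finite_halfSpace_inter n β h3 (u ∪ v)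
      simp only [Set.mem_iInter, Finset.mem_union] at ha
      refine ⟨a, ?_, ?_⟩
      · simp only [Set.mem_iInter]
        exact fun i hi => ha i (Or.inl hi)
      · simp only [Set.mem_iInter]
        exact fun i hi => ha i (Or.inr hi))
  exact ⟨a, fun i => Set.mem_iInter.1 ha i⟩

/-- Farkas' lemma for three half-planes, the first two of which have independent normals. -/
theorem farkas_three_of_cross_ne_zero (n₁ n₂ n₃ : Plane) (β₁ β₂ β₃ : ℝ)
    (hx : n₁ 0 * n₂ 1 - n₁ 1 * n₂ 0 ≠ 0)
    (h : ¬ ∃ a, a ∈ halfSpace n₁ β₁ ∧ a ∈ halfSpace n₂ β₂ ∧ a ∈ halfSpace n₃ β₃) :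
    ∃ c₁ c₂ c₃ : ℝ, 0 ≤ c₁ ∧ 0 ≤ c₂ ∧ 0 ≤ c₃ ∧
      (∀ i, c₁ * n₁ i + c₂ * n₂ i + c₃ * n₃ i = 0) ∧
      c₁ * β₁ + c₂ * β₂ + c₃ * β₃ < 0 := by
  push Not at h
  simp only [mem_halfSpace] at h
  set x := n₁ 0 * n₂ 1 - n₁ 1 * n₂ 0 with hxd
  -- `n₃ = -(c₁ n₁ + c₂ n₂)`; `key` evaluates at the point with `⟨·, n₁⟩ = β₁ - s` and
  -- `⟨·, n₂⟩ = β₂ - t`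
  set c₁ := -(n₃ 0 * n₂ 1 - n₃ 1 * n₂ 0) / x with hc₁
  set c₂ := -(n₁ 0 * n₃ 1 - n₁ 1 * n₃ 0) / x with hc₂
  have e0 : c₁ * n₁ 0 + c₂ * n₂ 0 + n₃ 0 = 0 := by
    rw [hc₁, hc₂]; field_simp; rw [hxd]; ring
  have e1 : c₁ * n₁ 1 + c₂ * n₂ 1 + n₃ 1 = 0 := by
    rw [hc₁, hc₂]; field_simp; rw [hxd]; ring
  have key : ∀ s t : ℝ, 0 ≤ s → 0 ≤ t → c₁ * (β₁ - s) + c₂ * (β₂ - t) + β₃ < 0 := by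
    intro s t hs ht
    have h1 : ((β₁ - s) * n₂ 1 - (β₂ - t) * n₁ 1) / x * n₁ 0 +
        ((β₂ - t) * n₁ 0 - (β₁ - s) * n₂ 0) / x * n₁ 1 = β₁ - s := by
      field_simp; rw [hxd]; ring
    have h2 : ((β₁ - s) * n₂ 1 - (β₂ - t) * n₁ 1) / x * n₂ 0 +
        ((β₂ - t) * n₁ 0 - (β₁ - s) * n₂ 0) / x * n₂ 1 = β₂ - t := by
      field_simp; rw [hxd]; ring
    set p := ((β₁ - s) * n₂ 1 - (β₂ - t) * n₁ 1) / x
    set q := ((β₂ - t) * n₁ 0 - (β₁ - s) * n₂ 0) / x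
    have h3 : β₃ < p * n₃ 0 + q * n₃ 1 := by
      simpa using h ![p, q] (by simpa using by linarith) (by simpa using by linarith)
    rw [show n₃ 0 = -(c₁ * n₁ 0 + c₂ * n₂ 0) by linarith,
      show n₃ 1 = -(c₁ * n₁ 1 + c₂ * n₂ 1) by linarith] at h3
    have h4 : c₁ * (β₁ - s) + c₂ * (β₂ - t) = c₁ * (β₁ - s) + c₂ * (β₂ - t) := rfl
    nth_rewrite 1 [← h1] at h4
    nth_rewrite 1 [← h2] at h4
    linarith
  have hc1 : 0 ≤ c₁ := by
    by_contra! hneg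
    -- This `s` adds |E| to E = c₁β₁ + c₂β₂ + β₃, which makes the left side of `key` nonnegative.
    have := key ((|c₁ * β₁ + c₂ * β₂ + β₃|) / (-c₁)) 0
      (div_nonneg (abs_nonneg _) (by linarith)) le_rfl
    have e : c₁ * (|c₁ * β₁ + c₂ * β₂ + β₃| / (-c₁)) = -|c₁ * β₁ + c₂ * β₂ + β₃| := by
      have := hneg.ne
      rw [div_neg, mul_neg, mul_div_cancel₀ _ this]
    rw [mul_sub, e] at this
    have := neg_abs_le (c₁ * β₁ + c₂ * β₂ + β₃)
    linarith
  have hc2 : 0 ≤ c₂ := by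
    by_contra! hneg
    have := key 0 ((|c₁ * β₁ + c₂ * β₂ + β₃|) / (-c₂)) le_rfl
      (div_nonneg (abs_nonneg _) (by linarith))
    have e : c₂ * (|c₁ * β₁ + c₂ * β₂ + β₃| / (-c₂)) = -|c₁ * β₁ + c₂ * β₂ + β₃| := by
      have := hneg.ne
      rw [div_neg, mul_neg, mul_div_cancel₀ _ this]
    rw [mul_sub c₂, e] at this
    have := neg_abs_le (c₁ * β₁ + c₂ * β₂ + β₃)
    linarith
  refine ⟨c₁, c₂, 1, hc1, hc2, zero_le_one, ?_, ?_⟩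
  · rw [Fin.forall_fin_two]
    exact ⟨by linarith, by linarith⟩
  · have := key 0 0 le_rfl le_rfl
    simp only [sub_zero] at this
    linarith

/-- Unit vectors of the plane that are linearly dependent are equal or opposite. -/
theorem eq_or_eq_neg_of_cross_eq_zero {n m : Plane} (hn : n 0 ^ 2 + n 1 ^ 2 = 1)
    (hm : m 0 ^ 2 + m 1 ^ 2 = 1) (hx : n 0 * m 1 - n 1 * m 0 = 0) :
    (∀ i, m i = n i) ∨ ∀ i, m i = -n i := by
  have hd : (n 0 * m 0 + n 1 * m 1) ^ 2 = 1 := by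
    have : (n 0 * m 0 + n 1 * m 1) ^ 2 + (n 0 * m 1 - n 1 * m 0) ^ 2 =
      (n 0 ^ 2 + n 1 ^ 2) * (m 0 ^ 2 + m 1 ^ 2) := by ring
    rw [hx, hn, hm] at this
    linarith
  have e0 : m 0 = (n 0 * m 0 + n 1 * m 1) * n 0 := by
    linear_combination (-m 0) * hn - n 1 * hx
  have e1 : m 1 = (n 0 * m 0 + n 1 * m 1) * n 1 := by
    linear_combination (-m 1) * hn + n 0 * hx
  rcases sq_eq_sq_iff_eq_or_eq_neg.1 (hd.trans (one_pow 2).symm) with h | h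
  · left; rw [Fin.forall_fin_two]; rw [h] at e0 e1; exact ⟨by linarith, by linarith⟩
  · right; rw [Fin.forall_fin_two]; rw [h] at e0 e1; exact ⟨by linarith, by linarith⟩

/-- Farkas' lemma for three half-planes with unit normals. -/
theorem farkas_three (n₁ n₂ n₃ : Plane) (β₁ β₂ β₃ : ℝ)
    (u₁ : n₁ 0 ^ 2 + n₁ 1 ^ 2 = 1) (u₂ : n₂ 0 ^ 2 + n₂ 1 ^ 2 = 1) (u₃ : n₃ 0 ^ 2 + n₃ 1 ^ 2 = 1)
    (h : ¬ ∃ a, a ∈ halfSpace n₁ β₁ ∧ a ∈ halfSpace n₂ β₂ ∧ a ∈ halfSpace n₃ β₃) :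
    ∃ c₁ c₂ c₃ : ℝ, 0 ≤ c₁ ∧ 0 ≤ c₂ ∧ 0 ≤ c₃ ∧
      (∀ i, c₁ * n₁ i + c₂ * n₂ i + c₃ * n₃ i = 0) ∧
      c₁ * β₁ + c₂ * β₂ + c₃ * β₃ < 0 := by
  by_cases h12 : n₁ 0 * n₂ 1 - n₁ 1 * n₂ 0 = 0
  swap
  · exact farkas_three_of_cross_ne_zero n₁ n₂ n₃ β₁ β₂ β₃ h12 h
  by_cases h13 : n₁ 0 * n₃ 1 - n₁ 1 * n₃ 0 = 0
  swap
  · obtain ⟨c₁, c₃, c₂, k₁, k₃, k₂, e, l⟩ :=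
      farkas_three_of_cross_ne_zero n₁ n₃ n₂ β₁ β₃ β₂ h13 (by
        rintro ⟨a, p, q, r⟩; exact h ⟨a, p, r, q⟩)
    exact ⟨c₁, c₂, c₃, k₁, k₂, k₃, fun i => by linarith [e i], by linarith⟩
  -- All normals are now ±n₁, so each half-plane constrains only the number ⟨a, n₁⟩, and the
  -- obstruction is a pair of disjoint opposite rays.
  have feas : ∀ t : ℝ, ∃ a : Plane, a 0 * n₁ 0 + a 1 * n₁ 1 = t := fun t =>
    ⟨fun i => t * n₁ i, by linear_combination t * u₁⟩
  simp only [mem_halfSpace] at h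
  rcases eq_or_eq_neg_of_cross_eq_zero u₁ u₂ h12 with e2 | e2 <;>
    rcases eq_or_eq_neg_of_cross_eq_zero u₁ u₃ h13 with e3 | e3 <;>
    simp only [e2, e3] at h ⊢
  · obtain ⟨a, ha⟩ := feas (min β₁ (min β₂ β₃))
    exact (h ⟨a, by simp [ha], by simp [ha], by simp [ha]⟩).elim
  · rcases le_total β₁ β₂ with hle | hle
    · refine ⟨1, 0, 1, by simp, by simp, by simp, fun i => by ring, ?_⟩
      by_contra! hn
      obtain ⟨a, ha⟩ := feas β₁
      exact h ⟨a, by linarith, by linarith, by linarith⟩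
    · refine ⟨0, 1, 1, by simp, by simp, by simp, fun i => by ring, ?_⟩
      by_contra! hn
      obtain ⟨a, ha⟩ := feas β₂
      exact h ⟨a, by linarith, by linarith, by linarith⟩
  · rcases le_total β₁ β₃ with hle | hle
    · refine ⟨1, 1, 0, by simp, by simp, by simp, fun i => by ring, ?_⟩
      by_contra! hn
      obtain ⟨a, ha⟩ := feas β₁
      exact h ⟨a, by linarith, by linarith, by linarith⟩
    · refine ⟨0, 1, 1, by simp, by simp, by simp, fun i => by ring, ?_⟩
      by_contra! hn
      obtain ⟨a, ha⟩ := feas β₃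
      exact h ⟨a, by linarith, by linarith, by linarith⟩
  · rcases le_total β₂ β₃ with hle | hle
    · refine ⟨1, 1, 0, by simp, by simp, by simp, fun i => by ring, ?_⟩
      by_contra! hn
      obtain ⟨a, ha⟩ := feas (-β₂)
      exact h ⟨a, by linarith, by linarith, by linarith⟩
    · refine ⟨1, 0, 1, by simp, by simp, by simp, fun i => by ring, ?_⟩
      by_contra! hn
      obtain ⟨a, ha⟩ := feas (-β₃)
      exact h ⟨a, by linarith, by linarith, by linarith⟩

/-! ### Angles and normals of half-planes, and the points that the criterion supplies. -/

/-- The cross product of the normals of two half-planes. -/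
def HalfPlane.cross (G G' : HalfPlane) : ℝ := G.normal 0 * G'.normal 1 - G.normal 1 * G'.normal 0

/-- The `ℓ¹`-norm of the normal of a half-plane. -/
def HalfPlane.mass (G : HalfPlane) : ℝ := |G.normal 0| + |G.normal 1|

theorem HalfPlane.mem_carrier {G : HalfPlane} {a : Plane} :
    a ∈ G.carrier ↔ a 0 * G.normal 0 + a 1 * G.normal 1 + G.offset ≤ 0 := by
  simp [HalfPlane.carrier, dotProduct, Fin.sum_univ_two]

/-- Supplementary angles have the same sine, and for unit vectors 1 - ⟨n, n'⟩² is the squared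
determinant. The denominators of the criterion thus become the determinants of Cramer's rule. -/
theorem HalfPlane.sin_boundaryAngle (G G' : HalfPlane) :
    Real.sin (G.boundaryAngle G') = |G.cross G'| := by
  have hn : ∀ G : HalfPlane, ‖G.direction‖ = 1 := fun G => by
    rw [EuclideanSpace.norm_eq, Real.sqrt_eq_one]
    simp [HalfPlane.direction, Fin.sum_univ_two]
    linarith [G.unit_normal]
  have h1 : Real.sin (G.boundaryAngle G') =
      Real.sin (InnerProductGeometry.angle G.direction G'.direction) := by
    unfold HalfPlane.boundaryAngle
    rcases min_choice (InnerProductGeometry.angle G.direction G'.direction)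
      (Real.pi - InnerProductGeometry.angle G.direction G'.direction) with h | h <;> rw [h]
    exact Real.sin_pi_sub _
  have h2 := InnerProductGeometry.cos_angle G.direction G'.direction
  rw [hn, hn] at h2
  simp [HalfPlane.direction, PiLp.inner_apply, Fin.sum_univ_two] at h2
  rw [h1, ← abs_of_nonneg (InnerProductGeometry.sin_angle_nonneg _ _), ← sq_eq_sq_iff_abs_eq_abs,
    Real.sin_sq]
  simp only [HalfPlane.direction] at h2 ⊢
  rw [h2, HalfPlane.cross]
  linear_combination (-(G'.normal 0 ^ 2 + G'.normal 1 ^ 2)) * G.unit_normal - G'.unit_normal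

theorem HalfPlane.abs_normal_le (G : HalfPlane) (i : Fin 2) : |G.normal i| ≤ 1 := by
  have := G.unit_normal
  rw [abs_le_one_iff_mul_self_le_one]
  revert i
  rw [Fin.forall_fin_two]
  constructor <;> nlinarith [sq_nonneg (G.normal 0), sq_nonneg (G.normal 1)]

theorem HalfPlane.one_le_mass (G : HalfPlane) : 1 ≤ G.mass := by
  unfold HalfPlane.mass
  have := G.unit_normal
  rw [← sq_abs, ← sq_abs (G.normal 1)] at this
  nlinarith [abs_nonneg (G.normal 0), abs_nonneg (G.normal 1), G.abs_normal_le 0,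
    G.abs_normal_le 1]

theorem abs_add_abs_le_sqrt {a b c : ℝ} (h : a ^ 2 + b ^ 2 = c ^ 2) (hc : 0 ≤ c) :
    |a| + |b| ≤ √2 * c := by
  rw [← pow_le_pow_iff_left₀ (by positivity) (by positivity) two_ne_zero, mul_pow, Real.sq_sqrt (by norm_num)]
  nlinarith [sq_abs a, sq_abs b, sq_nonneg (|a| - |b|)]

theorem HalfPlane.mass_le (G : HalfPlane) : G.mass ≤ √2 := by
  have := abs_add_abs_le_sqrt (c := 1) (by rw [G.unit_normal, one_pow]) zero_le_one
  rwa [mul_one] at this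

theorem sqrt_two_le : √2 ≤ 3 / 2 := by
  rw [Real.sqrt_le_left (by norm_num)]; norm_num

/-- Points realising the distance of two nonempty sets up to `ε`. -/
theorem exists_dist_le_of_setDist_le {A B : Set Plane} {r ε : ℝ} (hA : A.Nonempty)
    (hB : B.Nonempty) (hr : 0 ≤ r) (hε : 0 < ε) (h : setDist A B ≤ ENNReal.ofReal r) :
    ∃ a ∈ A, ∃ b ∈ B, dist a b ≤ r + ε := by
  rw [setDist, if_pos ⟨hA, hB⟩] at h
  have h' := h.trans_lt ((ENNReal.ofReal_lt_ofReal_iff (by linarith)).2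
    (show r < r + ε by linarith))
  simp only [iInf_lt_iff] at h'
  obtain ⟨a, ha, b, hb, hab⟩ := h'
  refine ⟨a, ha, b, hb, ?_⟩
  rw [edist_dist] at hab
  exact ((ENNReal.ofReal_lt_ofReal_iff (by linarith)).1 hab).le

theorem abs_sub_apply_le (a b : Plane) (i : Fin 2) : |a i - b i| ≤ dist a b := by
  rw [← Real.dist_eq]; exact dist_le_pi_dist a b i

theorem dist_plane_le {a b : Plane} {r : ℝ} (h0 : |a 0 - b 0| ≤ r) (h1 : |a 1 - b 1| ≤ r) :
    dist a b ≤ r := by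
  have hr : 0 ≤ r := (abs_nonneg _).trans h0
  rw [dist_pi_le_iff hr, Fin.forall_fin_two, Real.dist_eq, Real.dist_eq]
  exact ⟨h0, h1⟩

variable {M : Type*} [PseudoEMetricSpace M]

/-- The points that the criterion provides, in terms of bounds for its right-hand side. -/
theorem CoordinateFreeCriterion.exists_points {Hc : M → Set HalfPlane} {l : ℝ≥0}
    (h : CoordinateFreeCriterion Hc l) {z₁ z₂ z₃ z₄ x : M} {G₁ G₂ G₃ G₄ : HalfPlane}
    (m₁ : G₁ ∈ Hc z₁) (m₂ : G₂ ∈ Hc z₂) (m₃ : G₃ ∈ Hc z₃) (m₄ : G₄ ∈ Hc z₄)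
    (ne₁ : (G₁.carrier ∩ G₂.carrier).Nonempty) (ne₂ : (G₃.carrier ∩ G₄.carrier).Nonempty)
    {A B T ε : ℝ} (hA0 : 0 ≤ A) (hB0 : 0 ≤ B) (hT0 : 0 ≤ T) (hε : 0 < ε)
    (hA : edist z₁ z₂ / ENNReal.ofReal |G₁.cross G₂| ≤ ENNReal.ofReal A)
    (hB : edist z₃ z₄ / ENNReal.ofReal |G₃.cross G₄| ≤ ENNReal.ofReal B)
    (t₁ : edist x z₁ ≤ ENNReal.ofReal T) (t₂ : edist x z₂ ≤ ENNReal.ofReal T)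
    (t₃ : edist x z₃ ≤ ENNReal.ofReal T) (t₄ : edist x z₄ ≤ ENNReal.ofReal T) :
    ∃ p q, p ∈ G₁.carrier ∧ p ∈ G₂.carrier ∧ q ∈ G₃.carrier ∧ q ∈ G₄.carrier ∧
      ∀ i, |p i - q i| ≤ l * (A + B + 2 * T) + ε := by
  have hD : Metric.ediam {z₁, z₂, z₃, z₄} ≤ ENNReal.ofReal (2 * T) := by
    have hz : ∀ z ∈ ({z₁, z₂, z₃, z₄} : Set M), edist x z ≤ ENNReal.ofReal T := by
      simp only [Set.mem_insert_iff, Set.mem_singleton_iff, forall_eq_or_imp, forall_eq]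
      exact ⟨t₁, t₂, t₃, t₄⟩
    refine Metric.ediam_le fun a ha b hb => (edist_triangle_left a b x).trans ?_
    rw [two_mul, ENNReal.ofReal_add hT0 hT0]
    exact add_le_add (hz a ha) (hz b hb)
  have h1 := h z₁ z₂ z₃ z₄ G₁ m₁ G₂ m₂ G₃ m₃ G₄ m₄
  rw [HalfPlane.sin_boundaryAngle, HalfPlane.sin_boundaryAngle] at h1
  have h2 : setDist (G₁.carrier ∩ G₂.carrier) (G₃.carrier ∩ G₄.carrier) ≤
      ENNReal.ofReal (l * (A + B + 2 * T)) := by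
    refine h1.trans ?_
    rw [ENNReal.ofReal_mul (p := (l : ℝ)) l.2, ENNReal.ofReal_coe_nnreal, ENNReal.ofReal_add (by positivity)
      (by positivity), ENNReal.ofReal_add hA0 hB0]
    gcongr
  obtain ⟨p, hp, q, hq, hpq⟩ := exists_dist_le_of_setDist_le ne₁ ne₂ (by positivity) hε h2
  exact ⟨p, q, hp.1, hp.2, hq.1, hq.2, fun i => (abs_sub_apply_le p q i).trans hpq⟩

/-- Half-planes with non-parallel boundaries intersect. -/
theorem HalfPlane.inter_nonempty {G G' : HalfPlane} (h : G.cross G' ≠ 0) :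
    (G.carrier ∩ G'.carrier).Nonempty := by
  refine ⟨![(-G.offset * G'.normal 1 + G'.offset * G.normal 1) / G.cross G',
    (-G'.offset * G.normal 0 + G.offset * G'.normal 0) / G.cross G'], ?_, ?_⟩ <;>
  · rw [HalfPlane.mem_carrier]
    apply le_of_eq
    simp only [Matrix.cons_val_zero, Matrix.cons_val_one]
    field_simp
    unfold HalfPlane.cross
    ring

theorem HalfPlane.carrier_nonempty (G : HalfPlane) : G.carrier.Nonempty := by
  refine ⟨fun i => -G.offset * G.normal i, ?_⟩
  rw [HalfPlane.mem_carrier]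
  have := G.unit_normal
  apply le_of_eq
  linear_combination (-G.offset) * this

theorem edist_div_cross_le {z z' x : M} {G G' : HalfPlane} {r r' : ℝ} (hr : 0 ≤ r) (hr' : 0 ≤ r')
    (h : G.cross G' ≠ 0) (e : edist x z ≤ ENNReal.ofReal r) (e' : edist x z' ≤ ENNReal.ofReal r') :
    edist z z' / ENNReal.ofReal |G.cross G'| ≤ ENNReal.ofReal ((r + r') / |G.cross G'|) := by
  rw [ENNReal.ofReal_div_of_pos (abs_pos.2 h), ENNReal.ofReal_add hr hr']
  gcongr
  exact (edist_triangle_left z z' x).trans (add_le_add e e')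

theorem inner_le_of_abs_le {u w : Plane} {b s : ℝ} (hu : ∀ i, |u i| ≤ b)
    (hw : |w 0| + |w 1| ≤ s) : u 0 * w 0 + u 1 * w 1 ≤ s * b := by
  have hb : 0 ≤ b := (abs_nonneg _).trans (hu 0)
  have h0 : u 0 * w 0 ≤ b * |w 0| := by
    refine (le_abs_self _).trans ?_
    rw [abs_mul]
    exact mul_le_mul_of_nonneg_right (hu 0) (abs_nonneg _)
  have h1 : u 1 * w 1 ≤ b * |w 1| := by
    refine (le_abs_self _).trans ?_
    rw [abs_mul]
    exact mul_le_mul_of_nonneg_right (hu 1) (abs_nonneg _)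
  have := mul_le_mul_of_nonneg_right hw hb
  linarith

/-- The offsets of two half-planes with opposite normals. -/
theorem CoordinateFreeCriterion.offset_add_le_of_opposite {Hc : M → Set HalfPlane} {l : ℝ≥0}
    (h : CoordinateFreeCriterion Hc l) {z z' x : M} {G G' : HalfPlane} (m : G ∈ Hc z)
    (m' : G' ∈ Hc z') {r r' : ℝ} (hr : 0 ≤ r) (hr' : 0 ≤ r') (e : edist x z ≤ ENNReal.ofReal r)
    (e' : edist x z' ≤ ENNReal.ofReal r') (hn : ∀ i, G'.normal i = -G.normal i) :
    G.offset + G'.offset ≤ 3 * l * (r + r') := by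
  apply le_of_forall_pos_le_add
  intro ε hε
  have e1 : edist x z ≤ ENNReal.ofReal (r + r') :=
    e.trans (ENNReal.ofReal_le_ofReal (by linarith))
  have e2 : edist x z' ≤ ENNReal.ofReal (r + r') :=
    e'.trans (ENNReal.ofReal_le_ofReal (by linarith))
  -- Each pair repeats a single half-plane at a single point, so both quotients are 0/0 = 0 and only
  -- the diameter term survives.
  obtain ⟨p, q, hp, -, hq, -, hpq⟩ := h.exists_points m m m' m'
    (by simpa using G.carrier_nonempty) (by simpa using G'.carrier_nonempty) le_rfl le_rfl
    (by positivity : 0 ≤ r + r') (half_pos hε) (by simp) (by simp) e1 e1 e2 e2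
  rw [HalfPlane.mem_carrier] at hp hq
  rw [hn, hn] at hq
  have h1 := inner_le_of_abs_le (u := fun i => q i - p i) (w := G.normal)
    (fun i => by rw [abs_sub_comm]; exact hpq i) (G.mass_le.trans sqrt_two_le)
  linarith

/-! ### Positive relations between three normals. -/

set_option maxHeartbeats 600000 in
/-- The main estimate for the nonemptiness of the metric refinement: a positive relation between
three normals, the third coefficient of which is the largest. -/
theorem CoordinateFreeCriterion.offset_sum_le_of_max {Hc : M → Set HalfPlane} {l : ℝ≥0}
    (h : CoordinateFreeCriterion Hc l) {z₁ z₂ z₃ x : M} {G₁ G₂ G₃ : HalfPlane}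
    (m₁ : G₁ ∈ Hc z₁) (m₂ : G₂ ∈ Hc z₂) (m₃ : G₃ ∈ Hc z₃) {r₁ r₂ r₃ : ℝ}
    (hr₁ : 0 ≤ r₁) (hr₂ : 0 ≤ r₂) (hr₃ : 0 ≤ r₃) (e₁ : edist x z₁ ≤ ENNReal.ofReal r₁)
    (e₂ : edist x z₂ ≤ ENNReal.ofReal r₂) (e₃ : edist x z₃ ≤ ENNReal.ofReal r₃) {c₁ c₂ c₃ : ℝ}
    (hc₁ : 0 ≤ c₁) (hc₂ : 0 ≤ c₂) (h₁₃ : c₁ ≤ c₃) (h₂₃ : c₂ ≤ c₃)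
    (hc : ∀ i, c₁ * G₁.normal i + c₂ * G₂.normal i + c₃ * G₃.normal i = 0) :
    c₁ * G₁.offset + c₂ * G₂.offset + c₃ * G₃.offset ≤
      6 * l * (c₁ * r₁ + c₂ * r₂ + c₃ * r₃) := by
  have hl : 0 ≤ (l : ℝ) := l.2
  have hc0 := hc 0
  have hc1 := hc 1
  have u₁ := G₁.unit_normal
  have u₂ := G₂.unit_normal
  have u₃ := G₃.unit_normal
  have hc₃ : 0 ≤ c₃ := hc₁.trans h₁₃
  have hxx : c₂ * G₂.cross G₃ = -(c₁ * G₁.cross G₃) := by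
    unfold HalfPlane.cross
    linear_combination G₃.normal 1 * hc0 - G₃.normal 0 * hc1
  -- The vector c₁n₁ + c₃n₃ has length c₂ ≤ c₃, which forces the mixed term to be nonpositive.
  have hP : c₁ * c₃ * (G₁.normal 0 * G₃.normal 0 + G₁.normal 1 * G₃.normal 1) ≤ 0 := by
    have : c₁ ^ 2 + c₃ ^ 2 + 2 * (c₁ * c₃ *
      (G₁.normal 0 * G₃.normal 0 + G₁.normal 1 * G₃.normal 1)) = c₂ ^ 2 := by
      have e0 : c₁ * G₁.normal 0 + c₃ * G₃.normal 0 = -(c₂ * G₂.normal 0) := by linarith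
      have e1 : c₁ * G₁.normal 1 + c₃ * G₃.normal 1 = -(c₂ * G₂.normal 1) := by linarith
      linear_combination (-c₁ ^ 2) * u₁ + (-c₃ ^ 2) * u₃ + c₂ ^ 2 * u₂ +
        (c₁ * G₁.normal 0 + c₃ * G₃.normal 0 - c₂ * G₂.normal 0) * e0 +
        (c₁ * G₁.normal 1 + c₃ * G₃.normal 1 - c₂ * G₂.normal 1) * e1
    nlinarith
  have hQ : c₂ * c₃ * (G₂.normal 0 * G₃.normal 0 + G₂.normal 1 * G₃.normal 1) ≤ 0 := by
    have : c₂ ^ 2 + c₃ ^ 2 + 2 * (c₂ * c₃ *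
      (G₂.normal 0 * G₃.normal 0 + G₂.normal 1 * G₃.normal 1)) = c₁ ^ 2 := by
      have e0 : c₂ * G₂.normal 0 + c₃ * G₃.normal 0 = -(c₁ * G₁.normal 0) := by linarith
      have e1 : c₂ * G₂.normal 1 + c₃ * G₃.normal 1 = -(c₁ * G₁.normal 1) := by linarith
      linear_combination (-c₂ ^ 2) * u₂ + (-c₃ ^ 2) * u₃ + c₁ ^ 2 * u₁ +
        (c₂ * G₂.normal 0 + c₃ * G₃.normal 0 - c₁ * G₁.normal 0) * e0 +
        (c₂ * G₂.normal 1 + c₃ * G₃.normal 1 - c₁ * G₁.normal 1) * e1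
    nlinarith
  have hPQ : c₁ * (G₁.normal 0 * G₃.normal 0 + G₁.normal 1 * G₃.normal 1) +
      c₂ * (G₂.normal 0 * G₃.normal 0 + G₂.normal 1 * G₃.normal 1) = -c₃ := by
    linear_combination G₃.normal 0 * hc0 + G₃.normal 1 * hc1 - c₃ * u₃
  rcases hc₃.eq_or_lt with hz | hpos
  · have : c₁ = 0 := by linarith
    have : c₂ = 0 := by linarith
    subst_vars
    simp
  have hP' : c₁ * (G₁.normal 0 * G₃.normal 0 + G₁.normal 1 * G₃.normal 1) ≤ 0 := by
    by_contra! hn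
    have := mul_pos hpos hn
    linarith
  have hQ' : c₂ * (G₂.normal 0 * G₃.normal 0 + G₂.normal 1 * G₃.normal 1) ≤ 0 := by
    by_contra! hn
    have := mul_pos hpos hn
    linarith
  by_cases hdeg : c₁ * G₁.cross G₃ = 0
  · -- the normals with positive coefficients are parallel
    have opp₁ : c₁ = 0 ∨ ∀ i, G₃.normal i = -G₁.normal i := by
      rcases mul_eq_zero.1 hdeg with h0 | h0
      · exact Or.inl h0
      · rcases eq_or_eq_neg_of_cross_eq_zero u₁ u₃ h0 with h1 | h1
        · left
          rw [h1, h1, ← sq, ← sq, u₁] at hP'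
          linarith
        · exact Or.inr h1
    have opp₂ : c₂ = 0 ∨ ∀ i, G₃.normal i = -G₂.normal i := by
      rw [hdeg, neg_zero] at hxx
      rcases mul_eq_zero.1 hxx with h0 | h0
      · exact Or.inl h0
      · rcases eq_or_eq_neg_of_cross_eq_zero u₂ u₃ h0 with h1 | h1
        · left
          rw [h1, h1, ← sq, ← sq, u₂] at hQ'
          linarith
        · exact Or.inr h1
    have s₁ : c₁ * (G₁.normal 0 * G₃.normal 0 + G₁.normal 1 * G₃.normal 1) = -c₁ := by
      rcases opp₁ with h0 | h0
      · simp [h0]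
      · rw [h0, h0]; linear_combination (-c₁) * u₁
    have s₂ : c₂ * (G₂.normal 0 * G₃.normal 0 + G₂.normal 1 * G₃.normal 1) = -c₂ := by
      rcases opp₂ with h0 | h0
      · simp [h0]
      · rw [h0, h0]; linear_combination (-c₂) * u₂
    have hsum : c₃ = c₁ + c₂ := by linarith
    have b₁ : c₁ * (G₁.offset + G₃.offset) ≤ c₁ * (3 * l * (r₁ + r₃)) := by
      rcases opp₁ with h0 | h0
      · simp [h0]
      · exact mul_le_mul_of_nonneg_left
          (h.offset_add_le_of_opposite m₁ m₃ hr₁ hr₃ e₁ e₃ h0) hc₁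
    have b₂ : c₂ * (G₂.offset + G₃.offset) ≤ c₂ * (3 * l * (r₂ + r₃)) := by
      rcases opp₂ with h0 | h0
      · simp [h0]
      · exact mul_le_mul_of_nonneg_left
          (h.offset_add_le_of_opposite m₂ m₃ hr₂ hr₃ e₂ e₃ h0) hc₂
    have pos : 0 ≤ 3 * (l * (c₁ * r₁ + c₂ * r₂ + c₃ * r₃)) := by positivity
    rw [hsum] at pos ⊢
    linarith
  have hx₁ : G₁.cross G₃ ≠ 0 := right_ne_zero_of_mul hdeg
  have hdeg₂ : c₂ * G₂.cross G₃ ≠ 0 := by rw [hxx]; exact neg_ne_zero.2 hdeg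
  have hx₂ : G₂.cross G₃ ≠ 0 := right_ne_zero_of_mul hdeg₂
  have habs : c₂ * |G₂.cross G₃| = c₁ * |G₁.cross G₃| := by
    rw [← abs_of_nonneg hc₁, ← abs_of_nonneg hc₂, ← abs_mul, ← abs_mul, hxx, abs_neg]
  have hx1 : |G₁.cross G₃| ≤ 1 := by
    rw [← HalfPlane.sin_boundaryAngle]; exact Real.sin_le_one _
  have hx2 : |G₂.cross G₃| ≤ 1 := by
    rw [← HalfPlane.sin_boundaryAngle]; exact Real.sin_le_one _
  have κ₁ : c₁ * |G₁.cross G₃| ≤ c₁ := mul_le_of_le_one_right hc₁ hx1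
  have κ₂ : c₁ * |G₁.cross G₃| ≤ c₂ := habs ▸ mul_le_of_le_one_right hc₂ hx2
  have κ₀ : 0 ≤ c₁ * |G₁.cross G₃| := by positivity
  set κ := c₁ * |G₁.cross G₃| with hκ
  apply le_of_forall_pos_le_add
  intro ε hε
  have hε' : 0 < ε / (2 * (κ + 1)) := by positivity
  have T : ∀ {z r}, edist x z ≤ ENNReal.ofReal r → r ≤ r₁ + r₂ + r₃ →
      edist x z ≤ ENNReal.ofReal (r₁ + r₂ + r₃) :=
    fun h1 h2 => h1.trans (ENNReal.ofReal_le_ofReal h2)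
  -- The two pairs share G₃, the half-plane with the largest coefficient.
  obtain ⟨p, q, hp₁, hp₃, hq₂, hq₃, hpq⟩ := h.exists_points m₁ m₃ m₂ m₃
    (HalfPlane.inter_nonempty hx₁) (HalfPlane.inter_nonempty hx₂)
    (by positivity : 0 ≤ (r₁ + r₃) / |G₁.cross G₃|)
    (by positivity : 0 ≤ (r₂ + r₃) / |G₂.cross G₃|)
    (by positivity : 0 ≤ r₁ + r₂ + r₃) hε' (edist_div_cross_le hr₁ hr₃ hx₁ e₁ e₃)
    (edist_div_cross_le hr₂ hr₃ hx₂ e₂ e₃) (T e₁ (by linarith)) (T e₃ (by linarith))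
    (T e₂ (by linarith)) (T e₃ (by linarith))
  rw [HalfPlane.mem_carrier] at hp₁ hp₃ hq₂ hq₃
  set b := l * ((r₁ + r₃) / |G₁.cross G₃| + (r₂ + r₃) / |G₂.cross G₃| + 2 * (r₁ + r₂ + r₃)) +
    ε / (2 * (κ + 1)) with hb
  set P := -(c₁ * (G₁.normal 0 * G₃.normal 0 + G₁.normal 1 * G₃.normal 1)) with hPd
  set Q := -(c₂ * (G₂.normal 0 * G₃.normal 0 + G₂.normal 1 * G₃.normal 1)) with hQd
  have hP0 : 0 ≤ P := by linarith
  have hQ0 : 0 ≤ Q := by linarith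
  have hPQ' : P + Q = c₃ := by linarith
  -- The sum E of weighted offsets is at most c₂⟨p - q, n₂⟩ and at most -c₁⟨p - q, n₁⟩. Averaging
  -- with weights P and Q gives c₃E ≤ ⟨p - q, W⟩. This W is orthogonal to n₃ and has length only
  -- c₃κ, and the factor κ cancels both sines in the bound for p - q.
  let W : Plane := fun i => P * (c₂ * G₂.normal i) - Q * (c₁ * G₁.normal i)
  have hW3 : W 0 * G₃.normal 0 + W 1 * G₃.normal 1 = 0 := by
    simp only [W]
    linear_combination P * hQd - Q * hPd
  have hWx : W 0 * G₃.normal 1 - W 1 * G₃.normal 0 = -(c₃ * (c₁ * G₁.cross G₃)) := by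
    simp only [W]
    rw [← hPQ']
    unfold HalfPlane.cross at hxx ⊢
    linear_combination P * hxx
  have hWsq : W 0 ^ 2 + W 1 ^ 2 = (c₃ * κ) ^ 2 := by
    have : W 0 ^ 2 + W 1 ^ 2 = (W 0 * G₃.normal 0 + W 1 * G₃.normal 1) ^ 2 +
        (W 0 * G₃.normal 1 - W 1 * G₃.normal 0) ^ 2 := by
      linear_combination (-(W 0 ^ 2 + W 1 ^ 2)) * u₃
    rw [this, hW3, hWx, hκ]
    rw [mul_pow c₃, mul_pow c₁ |_|, sq_abs]
    ring
  have hWn : |W 0| + |W 1| ≤ 3 / 2 * (c₃ * κ) :=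
    (abs_add_abs_le_sqrt hWsq (by positivity)).trans
      (mul_le_mul_of_nonneg_right sqrt_two_le (by positivity))
  have h1 := inner_le_of_abs_le (u := fun i => p i - q i) hpq hWn
  have hp : c₁ * G₁.offset + c₂ * G₂.offset + c₃ * G₃.offset ≤
      c₂ * ((p 0 - q 0) * G₂.normal 0 + (p 1 - q 1) * G₂.normal 1) := by
    have a1 := mul_le_mul_of_nonneg_left hp₁ hc₁
    have a2 := mul_le_mul_of_nonneg_left hq₂ hc₂
    have a3 := mul_le_mul_of_nonneg_left hp₃ hc₃
    have a4 : p 0 * (c₁ * G₁.normal 0 + c₂ * G₂.normal 0 + c₃ * G₃.normal 0) +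
      p 1 * (c₁ * G₁.normal 1 + c₂ * G₂.normal 1 + c₃ * G₃.normal 1) = 0 := by
      rw [hc0, hc1]; ring
    linarith
  have hq : c₁ * G₁.offset + c₂ * G₂.offset + c₃ * G₃.offset ≤
      -(c₁ * ((p 0 - q 0) * G₁.normal 0 + (p 1 - q 1) * G₁.normal 1)) := by
    have a1 := mul_le_mul_of_nonneg_left hp₁ hc₁
    have a2 := mul_le_mul_of_nonneg_left hq₂ hc₂
    have a3 := mul_le_mul_of_nonneg_left hq₃ hc₃
    have a4 : q 0 * (c₁ * G₁.normal 0 + c₂ * G₂.normal 0 + c₃ * G₃.normal 0) +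
      q 1 * (c₁ * G₁.normal 1 + c₂ * G₂.normal 1 + c₃ * G₃.normal 1) = 0 := by
      rw [hc0, hc1]; ring
    linarith
  set E := c₁ * G₁.offset + c₂ * G₂.offset + c₃ * G₃.offset
  have h2 : c₃ * E ≤ c₃ * (3 / 2 * (κ * b)) := by
    have a1 := mul_le_mul_of_nonneg_left hp hP0
    have a2 := mul_le_mul_of_nonneg_left hq hQ0
    have a3 : c₃ * E = P * E + Q * E := by rw [← hPQ']; ring
    simp only [W] at h1
    linarith
  have h3 : E ≤ 3 / 2 * (κ * b) := le_of_mul_le_mul_left h2 hpos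
  have h4 : κ * b = l * (c₁ * (r₁ + r₃) + c₂ * (r₂ + r₃) + 2 * (κ * (r₁ + r₂ + r₃))) +
      κ * (ε / (2 * (κ + 1))) := by
    have i1 : κ * ((r₁ + r₃) / |G₁.cross G₃|) = c₁ * (r₁ + r₃) := by
      rw [hκ]; field_simp
    have i2 : κ * ((r₂ + r₃) / |G₂.cross G₃|) = c₂ * (r₂ + r₃) := by
      rw [← habs]; field_simp
    rw [hb, ← i1, ← i2]
    ring
  have h5 : κ * (ε / (2 * (κ + 1))) ≤ ε / 2 := by
    rw [← mul_div_assoc, div_le_div_iff₀ (by positivity) (by positivity)]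
    linarith
  -- Here κ ≤ c₁, c₂ ≤ c₃ is used. The 4, times the factor 3/2 in `h3`, gives the constant 6.
  have h6 : l * (c₁ * (r₁ + r₃) + c₂ * (r₂ + r₃) + 2 * (κ * (r₁ + r₂ + r₃))) ≤
      l * (4 * (c₁ * r₁ + c₂ * r₂ + c₃ * r₃)) := by
    apply mul_le_mul_of_nonneg_left _ hl
    have a1 := mul_le_mul_of_nonneg_right κ₁ hr₁
    have a2 := mul_le_mul_of_nonneg_right κ₂ hr₂
    have a3 := mul_le_mul_of_nonneg_right (κ₁.trans h₁₃) hr₃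
    have a4 := mul_le_mul_of_nonneg_right h₁₃ hr₃
    have a5 := mul_le_mul_of_nonneg_right h₂₃ hr₃
    have a6 : 0 ≤ c₁ * r₁ := by positivity
    have a7 : 0 ≤ c₂ * r₂ := by positivity
    linarith
  linarith

/-- A positive relation between three normals. -/
theorem CoordinateFreeCriterion.offset_sum_le {Hc : M → Set HalfPlane} {l : ℝ≥0}
    (h : CoordinateFreeCriterion Hc l) {z₁ z₂ z₃ x : M} {G₁ G₂ G₃ : HalfPlane}
    (m₁ : G₁ ∈ Hc z₁) (m₂ : G₂ ∈ Hc z₂) (m₃ : G₃ ∈ Hc z₃) {r₁ r₂ r₃ : ℝ}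
    (hr₁ : 0 ≤ r₁) (hr₂ : 0 ≤ r₂) (hr₃ : 0 ≤ r₃) (e₁ : edist x z₁ ≤ ENNReal.ofReal r₁)
    (e₂ : edist x z₂ ≤ ENNReal.ofReal r₂) (e₃ : edist x z₃ ≤ ENNReal.ofReal r₃) {c₁ c₂ c₃ : ℝ}
    (hc₁ : 0 ≤ c₁) (hc₂ : 0 ≤ c₂) (hc₃ : 0 ≤ c₃)
    (hc : ∀ i, c₁ * G₁.normal i + c₂ * G₂.normal i + c₃ * G₃.normal i = 0) :
    c₁ * G₁.offset + c₂ * G₂.offset + c₃ * G₃.offset ≤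
      6 * l * (c₁ * r₁ + c₂ * r₂ + c₃ * r₃) := by
  rcases le_total c₁ c₃ with h13 | h13
  · rcases le_total c₂ c₃ with h23 | h23
    · exact h.offset_sum_le_of_max m₁ m₂ m₃ hr₁ hr₂ hr₃ e₁ e₂ e₃ hc₁ hc₂ h13 h23 hc
    · have := h.offset_sum_le_of_max m₁ m₃ m₂ hr₁ hr₃ hr₂ e₁ e₃ e₂ hc₁ hc₃ (h13.trans h23) h23
        (fun i => by linarith [hc i])
      linarith
  · rcases le_total c₁ c₂ with h12 | h12
    · have := h.offset_sum_le_of_max m₁ m₃ m₂ hr₁ hr₃ hr₂ e₁ e₃ e₂ hc₁ hc₃ h12 (h13.trans h12)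
        (fun i => by linarith [hc i])
      linarith
    · have := h.offset_sum_le_of_max m₂ m₃ m₁ hr₂ hr₃ hr₁ e₂ e₃ e₁ hc₂ hc₃ h12 h13
        (fun i => by linarith [hc i])
      linarith

/-! ### Positive relations between four normals: the gap estimate. -/

/-- A ray that starts in the positive orthant stays there up to time `2` or hits a face. -/
theorem exists_exit_time (c k : Fin 4 → ℝ) (hc : ∀ i, 0 ≤ c i) :
    ∃ t, 0 ≤ t ∧ t ≤ 2 ∧ (∀ i, 0 ≤ c i + t * k i) ∧ (t = 2 ∨ ∃ i, c i + t * k i = 0) := by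
  have hcl : IsClosed {t : ℝ | ∀ i, 0 ≤ c i + t * k i} := by
    simp only [Set.ofPred_forall]
    exact isClosed_iInter fun i => isClosed_le continuous_const (by fun_prop)
  obtain ⟨t, ⟨⟨ht0, ht2⟩, ht⟩, hmax⟩ :=
    ((isCompact_Icc (a := (0 : ℝ)) (b := 2)).inter_right hcl).exists_isGreatest
      ⟨0, ⟨le_rfl, by norm_num⟩, fun i => by simpa using hc i⟩
  refine ⟨t, ht0, ht2, ht, ?_⟩
  by_contra! hcon
  have hlt : t < 2 := lt_of_le_of_ne ht2 hcon.1
  have hev : ∀ᶠ s in nhds t, ∀ i, 0 < c i + s * k i := by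
    rw [Filter.eventually_all]
    intro i
    have hcont : Continuous fun s : ℝ => c i + s * k i := by fun_prop
    exact hcont.continuousAt.eventually (lt_mem_nhds (lt_of_le_of_ne (ht i) (hcon.2 i).symm))
  have hev2 : ∀ᶠ s in nhdsWithin t (Set.Ioi t), (∀ i, 0 < c i + s * k i) ∧ s < 2 ∧ t < s :=
    (hev.filter_mono nhdsWithin_le_nhds).and
      (((gt_mem_nhds hlt).filter_mono nhdsWithin_le_nhds).and self_mem_nhdsWithin)
  obtain ⟨s, hs, hs2, hts⟩ := hev2.exists
  exact absurd (hmax ⟨⟨ht0.trans hts.le, hs2.le⟩, fun i => (hs i).le⟩) (not_le.2 hts)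

/-- Positive linear relations between four vectors of the plane. -/
def IsPosRel (n : Fin 4 → Plane) (c : Fin 4 → ℝ) : Prop :=
  (∀ i, 0 ≤ c i) ∧ ∀ j, c 0 * n 0 j + c 1 * n 1 j + c 2 * n 2 j + c 3 * n 3 j = 0

/-- The gap that a relation between four normals certifies. -/
def gap (β c : Fin 4 → ℝ) : ℝ := -(c 0 * β 0 + c 1 * β 1 + c 2 * β 2 + c 3 * β 3)

theorem norm_coeff_eq {n e : Plane} {c r : ℝ} (hn : n 0 ^ 2 + n 1 ^ 2 = 1)
    (he : e 0 ^ 2 + e 1 ^ 2 = r) (h : ∀ j, c * n j = e j) : c ^ 2 = r := by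
  rw [← he, ← h, ← h]
  linear_combination (-c ^ 2) * hn

section
variable {n : Fin 4 → Plane} {β c : Fin 4 → ℝ} {e : Plane} {τ θ : ℝ}

/-- If the two normals are equal, their coefficients add up to |e| = 1. If they are opposite, the
coefficients differ by 1; the common part m(n₀ + n₁) = 0 is itself a relation with gap at most 0, by
the second bound in `hT`, and without it the coefficients add up to 1. -/
theorem gap_le_of_cross_eq_zero_left (hn : ∀ i, n i 0 ^ 2 + n i 1 ^ 2 = 1)
    (he : e 0 ^ 2 + e 1 ^ 2 = 1)
    (hT : ∀ c, IsPosRel n c → gap β c ≤ τ * (c 0 + c 1) ∧ gap β c ≤ τ * (c 2 + c 3))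
    (hc : IsPosRel n c) (h01 : ∀ j, c 0 * n 0 j + c 1 * n 1 j = -e j)
    (hx : n 0 0 * n 1 1 - n 0 1 * n 1 0 = 0) : gap β c ≤ τ := by
  rcases eq_or_eq_neg_of_cross_eq_zero (hn 0) (hn 1) hx with h | h
  · have h1 : (c 0 + c 1) ^ 2 = 1 := norm_coeff_eq (hn 0) (e := fun j => -e j) (by simpa using he)
      (fun j => by rw [← h01 j, h]; ring)
    have h2 : c 0 + c 1 = 1 := by nlinarith [hc.1 0, hc.1 1]
    have := (hT c hc).1
    rwa [h2, mul_one] at this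
  · have h1 : (c 0 - c 1) ^ 2 = 1 := norm_coeff_eq (hn 0) (e := fun j => -e j) (by simpa using he)
      (fun j => by rw [← h01 j, h]; ring)
    set m := min (c 0) (c 1) with hm
    have hm0 : m ≤ c 0 := min_le_left _ _
    have hm1 : m ≤ c 1 := min_le_right _ _
    have hmm : 0 ≤ m := le_min (hc.1 0) (hc.1 1)
    have hsum : c 0 - m + (c 1 - m) = 1 := by
      rcases le_total (c 0) (c 1) with hle | hle
      · rw [min_eq_left hle] at hm; rw [hm]; nlinarith
      · rw [min_eq_right hle] at hm; rw [hm]; nlinarith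
    have a1 := (hT ![m, m, 0, 0] ⟨fun i => by fin_cases i <;> simp [hmm], fun j => by
      simp [h]⟩).2
    have a2 := (hT ![c 0 - m, c 1 - m, c 2, c 3] ⟨fun i => by
      fin_cases i <;> simp [hm0, hm1, hc.1 2, hc.1 3], fun j => by
      have := hc.2 j
      simp only [Matrix.cons_val] at this ⊢
      rw [h] at this ⊢
      linarith⟩).1
    simp only [gap, Matrix.cons_val] at a1 a2 ⊢
    rw [hsum] at a2
    linarith

/-- The situation is symmetric under exchanging the two pairs and replacing e by -e. -/
theorem gap_le_of_cross_eq_zero_right (hn : ∀ i, n i 0 ^ 2 + n i 1 ^ 2 = 1)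
    (he : e 0 ^ 2 + e 1 ^ 2 = 1)
    (hT : ∀ c, IsPosRel n c → gap β c ≤ τ * (c 0 + c 1) ∧ gap β c ≤ τ * (c 2 + c 3))
    (hc : IsPosRel n c) (h01 : ∀ j, c 0 * n 0 j + c 1 * n 1 j = -e j)
    (hx : n 2 0 * n 3 1 - n 2 1 * n 3 0 = 0) : gap β c ≤ τ := by
  have hswap : ∀ c : Fin 4 → ℝ, IsPosRel (![n 2, n 3, n 0, n 1]) c →
      IsPosRel n ![c 2, c 3, c 0, c 1] := fun c hc =>
    ⟨fun i => by fin_cases i <;> simp [hc.1], fun j => by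
      have := hc.2 j
      simp only [Matrix.cons_val] at this ⊢
      linarith⟩
  have hg : ∀ c : Fin 4 → ℝ, gap ![β 2, β 3, β 0, β 1] c = gap β ![c 2, c 3, c 0, c 1] :=
    fun c => by simp only [gap, Matrix.cons_val]; ring
  have key := gap_le_of_cross_eq_zero_left (n := ![n 2, n 3, n 0, n 1])
    (β := ![β 2, β 3, β 0, β 1]) (c := ![c 2, c 3, c 0, c 1]) (e := fun j => -e j) (τ := τ)
    (fun i => by fin_cases i <;> simp [hn]) (by simpa using he)
    (fun c hc => by
      have := hT _ (hswap c hc)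
      rw [hg]
      simpa [and_comm] using this)
    ⟨fun i => by fin_cases i <;> simp [hc.1], fun j => by
      have := hc.2 j
      simp only [Matrix.cons_val] at this ⊢
      linarith⟩
    (fun j => by
      have := hc.2 j
      have := h01 j
      simp only [Matrix.cons_val] at *
      linarith) (by simpa using hx)
  rw [hg] at key
  simpa [gap] using key

/-- A relation in which some coefficient vanishes has small coefficients. -/
theorem gap_le_of_coeff_eq_zero (hn : ∀ i, n i 0 ^ 2 + n i 1 ^ 2 = 1) (hτ : 0 ≤ τ)
    (he : e 0 ^ 2 + e 1 ^ 2 ≤ 9)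
    (hT : ∀ c, IsPosRel n c → gap β c ≤ τ * (c 0 + c 1) ∧ gap β c ≤ τ * (c 2 + c 3))
    (hc : IsPosRel n c) (h01 : ∀ j, c 0 * n 0 j + c 1 * n 1 j = -e j)
    {i : Fin 4} (hi : c i = 0) : gap β c ≤ 3 * τ := by
  have h23 : ∀ j, c 2 * n 2 j + c 3 * n 3 j = e j := fun j => by
    linarith [hc.2 j, h01 j]
  -- The surviving coefficient of the pair multiplies a unit vector to ±e, so it equals |e| ≤ 3.
  have bd : ∀ r : ℝ, r ^ 2 ≤ 9 → r ≤ 3 := fun r hr => by nlinarith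
  have fin : ∀ r, r ≤ 3 → gap β c ≤ τ * r → gap β c ≤ 3 * τ := fun r h1 h2 =>
    h2.trans (by nlinarith)
  obtain ⟨t1, t2⟩ := hT c hc
  fin_cases i <;> simp only [Fin.zero_eta, Fin.mk_one, Fin.reduceFinMk] at hi <;>
    simp only [hi, zero_mul, zero_add, add_zero] at h01 h23 t1 t2
  · refine fin _ (bd _ ?_) t1
    rw [norm_coeff_eq (hn 1) (e := fun j => -e j) rfl h01]
    simpa using he
  · refine fin _ (bd _ ?_) t1
    rw [norm_coeff_eq (hn 0) (e := fun j => -e j) rfl h01]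
    simpa using he
  · refine fin _ (bd _ ?_) t2
    rw [norm_coeff_eq (hn 3) (e := e) rfl h23]
    exact he
  · refine fin _ (bd _ ?_) t2
    rw [norm_coeff_eq (hn 2) (e := e) rfl h23]
    exact he

/-- |Y| ≤ w + |X| ≤ 2w, hence 1 ≤ 5w². In `gap_le`, X and Y are the coordinates of a normal in the
frame of e, and w is a coefficient times a determinant. -/
theorem quarter_le_of_abs_le {X Y σ w : ℝ} (h : X ^ 2 + Y ^ 2 = 1) (hσ : |σ| ≤ 1)
    (hw : |Y - σ * X| = w) (hX : |X| ≤ w) : 1 / 4 ≤ w := by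
  have h1 : |Y| ≤ w + |X| := by
    have : |Y| ≤ |Y - σ * X| + |σ * X| := by
      have := abs_add_le (Y - σ * X) (σ * X)
      rwa [sub_add_cancel] at this
    rw [abs_mul, hw] at this
    nlinarith [abs_nonneg X]
  rw [← sq_abs X, ← sq_abs Y] at h
  nlinarith [abs_nonneg X, abs_nonneg Y]

set_option maxHeartbeats 1000000 in
/-- The gap estimate: `hT` comes from the nonemptiness of the refinements, `hQ` from the criterion
for two pairs of half-planes. -/
theorem gap_le (hn : ∀ i, n i 0 ^ 2 + n i 1 ^ 2 = 1) (hτ : 0 ≤ τ) (hθ : θ ≤ 3 * τ)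
    (he : e 0 ^ 2 + e 1 ^ 2 = 1)
    (hT : ∀ c, IsPosRel n c → gap β c ≤ τ * (c 0 + c 1) ∧ gap β c ≤ τ * (c 2 + c 3))
    (hQ : ∀ (c : Fin 4 → ℝ) (v : Plane), IsPosRel n c →
      (∀ j, c 0 * n 0 j + c 1 * n 1 j = -v j) → (∀ j, |v j| ≤ 2) →
      1 / 4 ≤ c 0 * |n 0 0 * n 1 1 - n 0 1 * n 1 0| →
      1 / 4 ≤ c 1 * |n 0 0 * n 1 1 - n 0 1 * n 1 0| →
      1 / 4 ≤ c 2 * |n 2 0 * n 3 1 - n 2 1 * n 3 0| →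
      1 / 4 ≤ c 3 * |n 2 0 * n 3 1 - n 2 1 * n 3 0| → gap β c ≤ θ)
    (hc : IsPosRel n c) (h01 : ∀ j, c 0 * n 0 j + c 1 * n 1 j = -e j) : gap β c ≤ 3 * τ := by
  by_cases hx : n 0 0 * n 1 1 - n 0 1 * n 1 0 = 0
  · linarith [gap_le_of_cross_eq_zero_left hn he hT hc h01 hx]
  by_cases hy : n 2 0 * n 3 1 - n 2 1 * n 3 0 = 0
  · linarith [gap_le_of_cross_eq_zero_right hn he hT hc h01 hy]
  set x := n 0 0 * n 1 1 - n 0 1 * n 1 0 with hxd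
  set y := n 2 0 * n 3 1 - n 2 1 * n 3 0 with hyd
  -- the rotation `f` of `e`
  let f : Plane := ![-e 1, e 0]
  have f0 : f 0 = -e 1 := rfl
  have f1 : f 1 = e 0 := rfl
  let k : Fin 4 → ℝ := ![-(f 0 * n 1 1 - f 1 * n 1 0) / x, -(n 0 0 * f 1 - n 0 1 * f 0) / x,
    (f 0 * n 3 1 - f 1 * n 3 0) / y, (n 2 0 * f 1 - n 2 1 * f 0) / y]
  have k0 : k 0 = -(f 0 * n 1 1 - f 1 * n 1 0) / x := rfl
  have k1 : k 1 = -(n 0 0 * f 1 - n 0 1 * f 0) / x := rfl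
  have k2 : k 2 = (f 0 * n 3 1 - f 1 * n 3 0) / y := rfl
  have k3 : k 3 = (n 2 0 * f 1 - n 2 1 * f 0) / y := rfl
  have r01 : ∀ j, k 0 * n 0 j + k 1 * n 1 j = -f j := by
    rw [Fin.forall_fin_two, k0, k1]
    constructor
    · field_simp; rw [hxd]; ring
    · field_simp; rw [hxd]; ring
  have r23 : ∀ j, k 2 * n 2 j + k 3 * n 3 j = f j := by
    rw [Fin.forall_fin_two, k2, k3]
    constructor
    · field_simp; rw [hyd]; ring
    · field_simp; rw [hyd]; ring
  clear_value k
  have h23 : ∀ j, c 2 * n 2 j + c 3 * n 3 j = e j := fun j => by linarith [hc.2 j, h01 j]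
  let C : ℝ → Fin 4 → ℝ := fun σ i => c i + σ * k i
  have hC01 : ∀ σ j, C σ 0 * n 0 j + C σ 1 * n 1 j = -(e j + σ * f j) := fun σ j => by
    simp only [C]; linear_combination h01 j + σ * r01 j
  have hC23 : ∀ σ j, C σ 2 * n 2 j + C σ 3 * n 3 j = e j + σ * f j := fun σ j => by
    simp only [C]; linear_combination h23 j + σ * r23 j
  have hrel : ∀ σ, (∀ i, 0 ≤ C σ i) → IsPosRel n (C σ) := fun σ h =>
    ⟨h, fun j => by linarith [hC01 σ j, hC23 σ j]⟩
  have hgap : ∀ σ, gap β (C σ) = gap β c + σ * gap β k := fun σ => by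
    simp only [gap, C]; ring
  -- At a face of the orthant a coefficient vanishes, and |e + σf|² = 1 + σ² ≤ 5 lies below the 9
  -- that is allowed.
  have anchor : ∀ σ, |σ| ≤ 2 → (∀ i, 0 ≤ C σ i) → (∃ i, C σ i = 0) →
      gap β c + σ * gap β k ≤ 3 * τ := by
    rintro σ hσ hpos ⟨i, hi⟩
    rw [← hgap]
    refine gap_le_of_coeff_eq_zero hn hτ (e := fun j => e j + σ * f j) ?_ hT (hrel σ hpos)
      (hC01 σ) hi
    have h1 : σ ^ 2 ≤ 4 := by rw [← sq_abs]; nlinarith [abs_nonneg σ]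
    simp only [f0, f1]
    have : (e 0 + σ * -e 1) ^ 2 + (e 1 + σ * e 0) ^ 2 = 1 + σ ^ 2 := by
      linear_combination (1 + σ ^ 2) * he
    linarith
  have he01 : ∀ j, |e j| ≤ 1 := by
    intro j
    rw [abs_le_one_iff_mul_self_le_one]
    revert j
    rw [Fin.forall_fin_two]
    constructor <;> nlinarith [sq_nonneg (e 0), sq_nonneg (e 1)]
  -- If the coefficients remain nonnegative for one unit of σ in both directions, none of them is
  -- small relative to the determinant of its pair, and `hQ` applies.
  have middle : ∀ σ, |σ| ≤ 1 → (∀ i, |k i| ≤ C σ i) → gap β c + σ * gap β k ≤ 3 * τ := by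
    intro σ hσ hk
    have hpos : ∀ i, 0 ≤ C σ i := fun i => (abs_nonneg _).trans (hk i)
    have unitXY : ∀ i, (n i 0 * e 0 + n i 1 * e 1) ^ 2 + (n i 1 * e 0 - n i 0 * e 1) ^ 2 = 1 :=
      fun i => by linear_combination (e 0 ^ 2 + e 1 ^ 2) * hn i + he
    -- By Cramer's rule, coefficient times determinant is, up to sign, a cross product of the other
    -- normal of the pair with e + σf, or with f for `k`.
    have bound : ∀ (i i' : Fin 4) (z : ℝ),
        (C σ i * z = -(n i' 1 * e 0 - n i' 0 * e 1 - σ * (n i' 0 * e 0 + n i' 1 * e 1)) ∨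
          C σ i * z = n i' 1 * e 0 - n i' 0 * e 1 - σ * (n i' 0 * e 0 + n i' 1 * e 1)) →
        (k i * z = -(n i' 0 * e 0 + n i' 1 * e 1) ∨ k i * z = n i' 0 * e 0 + n i' 1 * e 1) →
        1 / 4 ≤ C σ i * |z| := by
      intro i i' z h1 h2
      refine quarter_le_of_abs_le (unitXY i') hσ ?_ ?_ (σ := σ)
      · rw [← abs_eq_abs.2 h1.symm, abs_mul, abs_of_nonneg (hpos i)]
      · rw [← abs_eq_abs.2 h2.symm, abs_mul]
        exact mul_le_mul_of_nonneg_right (hk i) (abs_nonneg _)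
    have q0 := hC01 σ 0
    have q1 := hC01 σ 1
    have q2 := hC23 σ 0
    have q3 := hC23 σ 1
    have p0 := r01 0
    have p1 := r01 1
    have p2 := r23 0
    have p3 := r23 1
    rw [f0] at q0 q2 p0 p2
    rw [f1] at q1 q3 p1 p3
    rw [← hgap]
    refine (hQ (C σ) (fun j => e j + σ * f j) (hrel σ hpos) (hC01 σ) ?_ ?_ ?_ ?_ ?_).trans hθ
    · have hf : ∀ j, |f j| ≤ 1 := by
        rw [Fin.forall_fin_two, f0, f1, abs_neg]
        exact ⟨he01 1, he01 0⟩
      intro j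
      have h1 := abs_add_le (e j) (σ * f j)
      rw [abs_mul] at h1
      have := he01 j
      have := mul_le_one₀ hσ (abs_nonneg _) (hf j)
      linarith
    · refine bound 0 1 x ?_ ?_
      · left; rw [hxd]; linear_combination n 1 1 * q0 - n 1 0 * q1
      · right; rw [hxd]; linear_combination n 1 1 * p0 - n 1 0 * p1
    · refine bound 1 0 x ?_ ?_
      · right; rw [hxd]; linear_combination (-n 0 1) * q0 + n 0 0 * q1
      · left; rw [hxd]; linear_combination (-n 0 1) * p0 + n 0 0 * p1
    · refine bound 2 3 y ?_ ?_
      · right; rw [hyd]; linear_combination n 3 1 * q2 - n 3 0 * q3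
      · left; rw [hyd]; linear_combination n 3 1 * p2 - n 3 0 * p3
    · refine bound 3 2 y ?_ ?_
      · left; rw [hyd]; linear_combination (-n 2 1) * q2 + n 2 0 * q3
      · right; rw [hyd]; linear_combination (-n 2 1) * p2 + n 2 0 * p3
  obtain ⟨b, hb0, hb2, hb, hb'⟩ := exists_exit_time c k hc.1
  obtain ⟨a, ha0, ha2, ha, ha'⟩ := exists_exit_time c (fun i => -k i) hc.1
  have haC : ∀ i, 0 ≤ c i + -a * k i := fun i => by linarith [ha i]
  have anchorb : b < 2 → gap β c + b * gap β k ≤ 3 * τ := fun h =>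
    anchor b (by rw [abs_of_nonneg hb0]; exact hb2) hb (hb'.resolve_left h.ne)
  have anchora : a < 2 → gap β c + -a * gap β k ≤ 3 * τ := fun h =>
    anchor (-a) (by rw [abs_neg, abs_of_nonneg ha0]; exact ha2) haC (by
      obtain ⟨i, hi⟩ := ha'.resolve_left h.ne
      exact ⟨i, by simp only [C]; linarith⟩)
  have convex : ∀ s t, 0 ≤ s → 0 ≤ t → gap β c + s * gap β k ≤ 3 * τ →
      gap β c + -t * gap β k ≤ 3 * τ → gap β c ≤ 3 * τ := by
    intro s t hs ht h1 h2
    rcases le_total 0 (gap β k) with hk | hk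
    · nlinarith [mul_nonneg hs hk]
    · nlinarith [mul_nonneg ht (neg_nonneg.2 hk)]
  -- The coefficients are nonnegative for σ in [-a, b]. If the interval is shorter than 2, both ends
  -- are faces. Otherwise its midpoint has margin at least 1 on both sides, and if the midpoint is
  -- not 0, then the end on the other side of 0 is a face.
  by_cases hab : a + b < 2
  · exact convex b a hb0 ha0 (anchorb (by linarith)) (anchora (by linarith))
  push Not at hab
  have hmid : gap β c + ((b - a) / 2) * gap β k ≤ 3 * τ := by
    refine middle _ ?_ ?_
    · rw [abs_le]; constructor <;> linarith
    · intro i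
      have h1 := hb i
      have h2 := haC i
      simp only [C]
      rw [abs_le]
      constructor <;> rcases le_total 0 (k i) with hk | hk <;> nlinarith
  rcases lt_trichotomy a b with hlt | heq | hlt
  · exact convex ((b - a) / 2) a (by linarith) ha0 hmid (anchora (by linarith))
  · rw [heq, sub_self] at hmid
    simpa using hmid
  · exact convex b ((a - b) / 2) hb0 (by linarith) (anchorb (by linarith))
      (by rw [show -((a - b) / 2) = (b - a) / 2 by ring]; exact hmid)

end

/-! ### The criterion for two well-spread pairs. -/

/-- The estimate that the criterion gives for two well-spread pairs of half-planes. -/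
theorem CoordinateFreeCriterion.offset_sum_le_of_pairs {Hc : M → Set HalfPlane} {l : ℝ≥0}
    (h : CoordinateFreeCriterion Hc l) {z₁ z₂ z₃ z₄ x y : M} {G₁ G₂ G₃ G₄ : HalfPlane}
    (m₁ : G₁ ∈ Hc z₁) (m₂ : G₂ ∈ Hc z₂) (m₃ : G₃ ∈ Hc z₃) (m₄ : G₄ ∈ Hc z₄)
    {r₁ r₂ r₃ r₄ δ : ℝ} (hr₁ : 0 ≤ r₁) (hr₂ : 0 ≤ r₂) (hr₃ : 0 ≤ r₃) (hr₄ : 0 ≤ r₄) (hδ : 0 ≤ δ)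
    (e₁ : edist x z₁ ≤ ENNReal.ofReal r₁) (e₂ : edist x z₂ ≤ ENNReal.ofReal r₂)
    (e₃ : edist y z₃ ≤ ENNReal.ofReal r₃) (e₄ : edist y z₄ ≤ ENNReal.ofReal r₄)
    (exy : edist x y ≤ ENNReal.ofReal δ) {c₁ c₂ c₃ c₄ : ℝ} {v : Plane}
    (hc₁ : 0 ≤ c₁) (hc₂ : 0 ≤ c₂) (hc₃ : 0 ≤ c₃) (hc₄ : 0 ≤ c₄)
    (h₁₂ : ∀ j, c₁ * G₁.normal j + c₂ * G₂.normal j = -v j)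
    (h₃₄ : ∀ j, c₃ * G₃.normal j + c₄ * G₄.normal j = v j) (hv : ∀ j, |v j| ≤ 2)
    (q₁ : 1 / 4 ≤ c₁ * |G₁.cross G₂|) (q₂ : 1 / 4 ≤ c₂ * |G₁.cross G₂|)
    (q₃ : 1 / 4 ≤ c₃ * |G₃.cross G₄|) (q₄ : 1 / 4 ≤ c₄ * |G₃.cross G₄|) :
    c₁ * G₁.offset + c₂ * G₂.offset + c₃ * G₃.offset + c₄ * G₄.offset ≤
      48 * l * (c₁ * r₁ + c₂ * r₂ + c₃ * r₃ + c₄ * r₄) + 8 * l * δ := by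
  have hl : 0 ≤ (l : ℝ) := l.2
  have hx : G₁.cross G₂ ≠ 0 := fun h0 => by rw [h0] at q₁; norm_num at q₁
  have hy : G₃.cross G₄ ≠ 0 := fun h0 => by rw [h0] at q₃; norm_num at q₃
  have hx1 : |G₁.cross G₂| ≤ 1 := by
    rw [← HalfPlane.sin_boundaryAngle]; exact Real.sin_le_one _
  have hy1 : |G₃.cross G₄| ≤ 1 := by
    rw [← HalfPlane.sin_boundaryAngle]; exact Real.sin_le_one _
  have hdiv : ∀ {c r w : ℝ}, 0 ≤ r → 0 < w → 1 / 4 ≤ c * w → r / w ≤ 4 * (c * r) := by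
    intro c r w hr hw hq
    rw [div_le_iff₀ hw]
    nlinarith
  have hle : ∀ {c r w : ℝ}, 0 ≤ c → 0 ≤ r → w ≤ 1 → 1 / 4 ≤ c * w → r ≤ 4 * (c * r) := by
    intro c r w hc hr hw hq
    have : 1 / 4 ≤ c := hq.trans (mul_le_of_le_one_right hc hw)
    nlinarith
  have a₁ := hdiv hr₁ (abs_pos.2 hx) q₁
  have a₂ := hdiv hr₂ (abs_pos.2 hx) q₂
  have a₃ := hdiv hr₃ (abs_pos.2 hy) q₃
  have a₄ := hdiv hr₄ (abs_pos.2 hy) q₄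
  have b₁ := hle hc₁ hr₁ hx1 q₁
  have b₂ := hle hc₂ hr₂ hx1 q₂
  have b₃ := hle hc₃ hr₃ hy1 q₃
  have b₄ := hle hc₄ hr₄ hy1 q₄
  set T := r₁ + r₂ + r₃ + r₄ + δ with hT
  have hT0 : 0 ≤ T := by positivity
  have tx : ∀ {z r}, edist x z ≤ ENNReal.ofReal r → r ≤ T → edist x z ≤ ENNReal.ofReal T :=
    fun h1 h2 => h1.trans (ENNReal.ofReal_le_ofReal h2)
  have ty : ∀ {z r}, 0 ≤ r → edist y z ≤ ENNReal.ofReal r → r + δ ≤ T →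
      edist x z ≤ ENNReal.ofReal T := fun h0 h1 h2 =>
    (edist_triangle x y _).trans ((add_le_add exy h1).trans (by
      rw [← ENNReal.ofReal_add hδ h0]; exact ENNReal.ofReal_le_ofReal (by linarith)))
  apply le_of_forall_pos_le_add
  intro ε hε
  obtain ⟨p, q, hp₁, hp₂, hq₃, hq₄, hpq⟩ := h.exists_points m₁ m₂ m₃ m₄
    (HalfPlane.inter_nonempty hx) (HalfPlane.inter_nonempty hy)
    (by positivity : 0 ≤ (r₁ + r₂) / |G₁.cross G₂|)
    (by positivity : 0 ≤ (r₃ + r₄) / |G₃.cross G₄|) hT0 (by positivity : 0 < ε / 4)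
    (edist_div_cross_le hr₁ hr₂ hx e₁ e₂) (edist_div_cross_le hr₃ hr₄ hy e₃ e₄)
    (tx e₁ (by linarith)) (tx e₂ (by linarith)) (ty hr₃ e₃ (by linarith))
    (ty hr₄ e₄ (by linarith))
  rw [HalfPlane.mem_carrier] at hp₁ hp₂ hq₃ hq₄
  have h1 := inner_le_of_abs_le (u := fun i => p i - q i) (w := v) (s := 4) hpq (by
    linarith [hv 0, hv 1])
  have h2 : c₁ * G₁.offset + c₂ * G₂.offset ≤ p 0 * v 0 + p 1 * v 1 := by
    have i1 := mul_le_mul_of_nonneg_left hp₁ hc₁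
    have i2 := mul_le_mul_of_nonneg_left hp₂ hc₂
    have i3 : p 0 * (c₁ * G₁.normal 0 + c₂ * G₂.normal 0) +
      p 1 * (c₁ * G₁.normal 1 + c₂ * G₂.normal 1) = p 0 * -v 0 + p 1 * -v 1 := by
      rw [h₁₂, h₁₂]
    linarith
  have h3 : c₃ * G₃.offset + c₄ * G₄.offset ≤ -(q 0 * v 0 + q 1 * v 1) := by
    have i1 := mul_le_mul_of_nonneg_left hq₃ hc₃
    have i2 := mul_le_mul_of_nonneg_left hq₄ hc₄
    have i3 : q 0 * (c₃ * G₃.normal 0 + c₄ * G₄.normal 0) +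
      q 1 * (c₃ * G₃.normal 1 + c₄ * G₄.normal 1) = q 0 * v 0 + q 1 * v 1 := by
      rw [h₃₄, h₃₄]
    linarith
  -- Each radius, divided by its sine or not, is at most 4 times coefficient times radius: the
  -- quotients contribute 4 and 2T contributes 8. With the ℓ¹-norm of v at most 4 this yields 48 and
  -- 8.
  have h4 : (r₁ + r₂) / |G₁.cross G₂| + (r₃ + r₄) / |G₃.cross G₄| + 2 * T ≤
      12 * (c₁ * r₁ + c₂ * r₂ + c₃ * r₃ + c₄ * r₄) + 2 * δ := by
    rw [add_div, add_div]
    linarith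
  have h5 := mul_le_mul_of_nonneg_left h4 hl
  generalize (r₁ + r₂) / |G₁.cross G₂| + (r₃ + r₄) / |G₃.cross G₄| + 2 * T = W at h1 h5
  linarith

/-! ### Metric refinements. -/

/-- The metric refinement with constant `k`, relaxed by `δ`: the points that satisfy, for every
half-plane attached to a point `y` at a finite distance from `x`, the defining inequality of its
neighbourhood of radius `k ρ(x, y) + δ`. -/
def refinement (Hc : M → Set HalfPlane) (k : ℝ) (x : M) (δ : ℝ) : Set Plane :=
  {a | ∀ y, ∀ G ∈ Hc y, edist x y ≠ ⊤ → a 0 * G.normal 0 + a 1 * G.normal 1 + G.offset ≤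
    (k * (edist x y).toReal + δ) * G.mass}

/-- The half-planes that constrain the metric refinement at `x`. -/
abbrev Constr (Hc : M → Set HalfPlane) (x : M) : Type _ :=
  {p : M × HalfPlane // p.2 ∈ Hc p.1 ∧ edist x p.1 ≠ ⊤}

/-- The bound that a constraint puts on the metric refinement. -/
def Constr.bound {Hc : M → Set HalfPlane} {x : M} (k : ℝ) (p : Constr Hc x) : ℝ :=
  k * (edist x p.1.1).toReal * p.1.2.mass - p.1.2.offset

section
variable {Hc : M → Set HalfPlane} {k : ℝ} {x y : M} {δ : ℝ} {B : ConvexBody Plane} {l : ℝ≥0}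

theorem mem_refinement_zero {a : Plane} : a ∈ refinement Hc k x 0 ↔
    ∀ p : Constr Hc x, a ∈ halfSpace p.1.2.normal (p.bound k) := by
  simp only [refinement, Set.mem_ofPred_eq, add_zero, mem_halfSpace, Constr.bound, Subtype.forall,
    Prod.forall]
  constructor
  · intro h y G hG
    have := h y G hG.1 hG.2
    linarith
  · intro h y G hG hy
    have := h y G ⟨hG, hy⟩
    linarith

theorem convex_refinement : Convex ℝ (refinement Hc k x δ) := by
  have : refinement Hc k x δ = ⋂ (y) (G ∈ Hc y) (_ : edist x y ≠ ⊤),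
      halfSpace G.normal ((k * (edist x y).toReal + δ) * G.mass - G.offset) := by
    ext a
    simp only [refinement, Set.mem_ofPred_eq, Set.mem_iInter, mem_halfSpace, le_sub_iff_add_le]
  rw [this]
  exact convex_iInter fun y => convex_iInter₂ fun G _ => convex_iInter fun _ =>
    convex_halfSpace _ _

theorem isClosed_refinement : IsClosed (refinement Hc k x 0) := by
  have : refinement Hc k x 0 = ⋂ p : Constr Hc x, halfSpace p.1.2.normal (p.bound k) := by
    ext a
    rw [mem_refinement_zero, Set.mem_iInter]
  rw [this]
  exact isClosed_iInter fun p => isClosed_halfSpace _ _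

theorem refinement_subset (hB : (B : Set Plane) = ⋂ G ∈ Hc x, G.carrier) :
    refinement Hc k x 0 ⊆ B := by
  intro a ha
  rw [hB]
  simp only [Set.mem_iInter]
  intro G hG
  have := ha x G hG (by simp)
  rw [HalfPlane.mem_carrier]
  simpa using this

theorem isCompact_refinement (hB : (B : Set Plane) = ⋂ G ∈ Hc x, G.carrier) :
    IsCompact (refinement Hc k x 0) :=
  B.isCompact.of_isClosed_subset isClosed_refinement (refinement_subset hB)

theorem refinement_mono {δ' : ℝ} (h : δ ≤ δ') : refinement Hc k x δ ⊆ refinement Hc k x δ' :=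
  fun _ ha y G hG hy => (ha y G hG hy).trans (mul_le_mul_of_nonneg_right (by linarith)
    (zero_le_one.trans G.one_le_mass))

/-- The triangle inequality: each constraint at y has a counterpart at x with radius smaller by at
most kρ(x,y). -/
theorem refinement_subset_of_edist (hk : 0 ≤ k) (hxy : edist x y ≠ ⊤)
    (hδ : k * (edist x y).toReal ≤ δ) : refinement Hc k y 0 ⊆ refinement Hc k x δ := by
  intro a ha z G hG hxz
  have hyz : edist y z ≠ ⊤ := ne_top_of_le_ne_top (ENNReal.add_ne_top.2 ⟨hxy, hxz⟩)
    (edist_triangle_left y z x)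
  refine (ha z G hG hyz).trans (mul_le_mul_of_nonneg_right ?_
    (zero_le_one.trans G.one_le_mass))
  have h1 : (edist y z).toReal ≤ (edist x y).toReal + (edist x z).toReal := by
    rw [← ENNReal.toReal_add hxy hxz]
    exact ENNReal.toReal_mono (ENNReal.add_ne_top.2 ⟨hxy, hxz⟩) (edist_triangle_left y z x)
  have := mul_le_mul_of_nonneg_left h1 hk
  linarith

/-- Helly's theorem for a metric refinement and some more half-planes. -/
theorem exists_mem_refinement (hB : (B : Set Plane) = ⋂ G ∈ Hc x, G.carrier) {ι : Type*}
    (n : ι → Plane) (β : ι → ℝ)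
    (h3 : ∀ i j m : Constr Hc x ⊕ ι, ∃ a,
      a ∈ halfSpace (Sum.elim (fun p => p.1.2.normal) n i) (Sum.elim (Constr.bound k) β i) ∧
      a ∈ halfSpace (Sum.elim (fun p => p.1.2.normal) n j) (Sum.elim (Constr.bound k) β j) ∧
      a ∈ halfSpace (Sum.elim (fun p => p.1.2.normal) n m) (Sum.elim (Constr.bound k) β m)) :
    ∃ a ∈ refinement Hc k x 0, ∀ j, a ∈ halfSpace (n j) (β j) := by
  -- The constraints attached to x itself have radius 0 and cut out the compact set B; this is the
  -- bounded subfamily that Helly's theorem needs.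
  have hJ : (⋂ i ∈ {i : Constr Hc x ⊕ ι | ∃ p : Constr Hc x, i = Sum.inl p ∧ p.1.1 = x},
      halfSpace (Sum.elim (fun p => p.1.2.normal) n i) (Sum.elim (Constr.bound k) β i)) =
      (B : Set Plane) := by
    rw [hB]
    ext a
    simp only [Set.mem_iInter, Set.mem_ofPred_eq]
    constructor
    · intro h G hG
      have := h (Sum.inl ⟨(x, G), hG, by simp⟩) ⟨_, rfl, rfl⟩
      rw [HalfPlane.mem_carrier]
      simp only [Sum.elim_inl, mem_halfSpace, Constr.bound, edist_self, ENNReal.toReal_zero] at this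
      linarith
    · rintro h i ⟨⟨⟨z, G⟩, hG, hz⟩, rfl, h0⟩
      simp only at h0
      subst h0
      have := HalfPlane.mem_carrier.1 (h G hG)
      simp only [Sum.elim_inl, mem_halfSpace, Constr.bound, edist_self, ENNReal.toReal_zero]
      linarith
  obtain ⟨a, ha⟩ := halfSpace_inter_nonempty _ _ _ (by rw [hJ]; exact B.nonempty)
    (by rw [hJ]; exact B.isCompact.isBounded) h3
  exact ⟨a, mem_refinement_zero.2 fun p => ha (Sum.inl p), fun j => ha (Sum.inr j)⟩

theorem Constr.edist_le (p : Constr Hc x) :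
    edist x p.1.1 ≤ ENNReal.ofReal (edist x p.1.1).toReal :=
  (ENNReal.ofReal_toReal p.2.2).ge

/-- The criterion makes the metric refinements nonempty. -/
theorem CoordinateFreeCriterion.refinement_nonempty (h : CoordinateFreeCriterion Hc l)
    (hB : (B : Set Plane) = ⋂ G ∈ Hc x, G.carrier) (hk : 6 * l ≤ k) :
    (refinement Hc k x 0).Nonempty := by
  obtain ⟨a, ha, -⟩ := exists_mem_refinement (k := k) hB (ι := PEmpty.{1}) (fun i => i.elim)
    (fun i => i.elim) (by
      rintro (p | ⟨⟨⟩⟩) (q | ⟨⟨⟩⟩) (r | ⟨⟨⟩⟩)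
      simp only [Sum.elim_inl]
      by_contra hcon
      obtain ⟨c₁, c₂, c₃, hc₁, hc₂, hc₃, hrel, hneg⟩ := farkas_three _ _ _ _ _ _
        p.1.2.unit_normal q.1.2.unit_normal r.1.2.unit_normal hcon
      have h1 := h.offset_sum_le p.2.1 q.2.1 r.2.1 ENNReal.toReal_nonneg ENNReal.toReal_nonneg
        ENNReal.toReal_nonneg p.edist_le q.edist_le r.edist_le hc₁ hc₂ hc₃ hrel
      have hk0 : 0 ≤ k := le_trans (by positivity) hk
      have key : ∀ (p : Constr Hc x) (c : ℝ), 0 ≤ c →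
          6 * l * (c * (edist x p.1.1).toReal) ≤
            c * (k * (edist x p.1.1).toReal * p.1.2.mass) := by
        intro p c hc
        have hr : 0 ≤ (edist x p.1.1).toReal := ENNReal.toReal_nonneg
        have i1 : 6 * l * (c * (edist x p.1.1).toReal) ≤ k * (c * (edist x p.1.1).toReal) :=
          mul_le_mul_of_nonneg_right hk (by positivity)
        have i2 : c * k * (edist x p.1.1).toReal * 1 ≤
            c * k * (edist x p.1.1).toReal * p.1.2.mass :=
          mul_le_mul_of_nonneg_left p.1.2.one_le_mass (by positivity)
        linarith
      have k1 := key p c₁ hc₁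
      have k2 := key q c₂ hc₂
      have k3 := key r c₃ hc₃
      simp only [Constr.bound] at hneg
      linarith)
  exact ⟨a, ha⟩

/-- Linear programming duality for the minimum of `⟨·, e⟩` on a metric refinement. -/
theorem exists_dual (hB : (B : Set Plane) = ⋂ G ∈ Hc x, G.carrier)
    (hne : (refinement Hc k x 0).Nonempty) {e : Plane} (he : e 0 ^ 2 + e 1 ^ 2 = 1) {s : ℝ}
    (hs : ∀ a ∈ refinement Hc k x 0, s < a 0 * e 0 + a 1 * e 1) :
    ∃ (p q : Constr Hc x) (c₁ c₂ : ℝ), 0 ≤ c₁ ∧ 0 ≤ c₂ ∧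
      (∀ j, c₁ * p.1.2.normal j + c₂ * q.1.2.normal j = -e j) ∧
      s < -(c₁ * p.bound k + c₂ * q.bound k) := by
  have hun : ∀ i : Constr Hc x ⊕ Unit,
      Sum.elim (fun p : Constr Hc x => p.1.2.normal) (fun _ : Unit => e) i 0 ^ 2 +
      Sum.elim (fun p : Constr Hc x => p.1.2.normal) (fun _ : Unit => e) i 1 ^ 2 = 1 := by
    rintro (p | _)
    · exact p.1.2.unit_normal
    · exact he
  by_contra hcon
  obtain ⟨a₀, ha₀⟩ := hne
  have ha₀' := mem_refinement_zero.1 ha₀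
  have fin : ∀ (p q : Constr Hc x) (c₁ c₂ c₃ : ℝ), 0 ≤ c₁ → 0 ≤ c₂ → 0 ≤ c₃ →
      (∀ j, c₁ * p.1.2.normal j + c₂ * q.1.2.normal j + c₃ * e j = 0) →
      c₁ * p.bound k + c₂ * q.bound k + c₃ * s < 0 → False := by
    intro p q c₁ c₂ c₃ hc₁ hc₂ hc₃ hrel hneg
    have hp := mul_le_mul_of_nonneg_left (mem_halfSpace.1 (ha₀' p)) hc₁
    have hq := mul_le_mul_of_nonneg_left (mem_halfSpace.1 (ha₀' q)) hc₂
    have hsum : a₀ 0 * (c₁ * p.1.2.normal 0 + c₂ * q.1.2.normal 0 + c₃ * e 0) +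
      a₀ 1 * (c₁ * p.1.2.normal 1 + c₂ * q.1.2.normal 1 + c₃ * e 1) = 0 := by
      rw [hrel, hrel]; ring
    -- Without the objective, the relation would contradict the point a₀ of the refinement.
    have hpos : 0 < c₃ := by
      refine lt_of_le_of_ne hc₃ fun h0 => ?_
      rw [← h0] at hneg hsum
      linarith
    refine hcon ⟨p, q, c₁ / c₃, c₂ / c₃, by positivity, by positivity, fun j => ?_, ?_⟩
    · have := hrel j
      field_simp
      linarith
    · have : c₁ / c₃ * p.bound k + c₂ / c₃ * q.bound k =
        (c₁ * p.bound k + c₂ * q.bound k) / c₃ := by ring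
      rw [this, ← neg_div, lt_div_iff₀ hpos]
      linarith
  -- Adding the half-plane ⟨·, e⟩ ≤ s makes the system infeasible, so three of its members are
  -- already infeasible. The cases below are told apart by which of the three are the added one, and
  -- its repetitions are merged.
  have h3 : ¬ ∀ i j m : Constr Hc x ⊕ Unit, _ := fun h3 => by
    obtain ⟨a, ha, ha'⟩ := exists_mem_refinement (k := k) hB (fun _ : Unit => e) (fun _ => s) h3
    exact absurd (mem_halfSpace.1 (ha' ())) (not_le.2 (hs a ha))
  push Not at h3
  obtain ⟨i, j, m, h3⟩ := h3
  obtain ⟨c₁, c₂, c₃, hc₁, hc₂, hc₃, hrel, hneg⟩ := farkas_three _ _ _ _ _ _ (hun i) (hun j)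
    (hun m) (fun ⟨a, h⟩ => h3 a h.1 h.2.1 h.2.2)
  rcases i with p | _ <;> rcases j with q | _ <;> rcases m with r | _ <;>
    simp only [Sum.elim_inl, Sum.elim_inr] at hrel hneg
  · have hp := mul_le_mul_of_nonneg_left (mem_halfSpace.1 (ha₀' p)) hc₁
    have hq := mul_le_mul_of_nonneg_left (mem_halfSpace.1 (ha₀' q)) hc₂
    have hr := mul_le_mul_of_nonneg_left (mem_halfSpace.1 (ha₀' r)) hc₃
    have hsum : a₀ 0 * (c₁ * p.1.2.normal 0 + c₂ * q.1.2.normal 0 + c₃ * r.1.2.normal 0) +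
      a₀ 1 * (c₁ * p.1.2.normal 1 + c₂ * q.1.2.normal 1 + c₃ * r.1.2.normal 1) = 0 := by
      rw [hrel, hrel]; ring
    linarith
  · exact fin p q c₁ c₂ c₃ hc₁ hc₂ hc₃ hrel hneg
  · exact fin p r c₁ c₃ c₂ hc₁ hc₃ hc₂ (fun j => by linarith [hrel j]) (by linarith)
  · exact fin p p c₁ 0 (c₂ + c₃) hc₁ le_rfl (by positivity) (fun j => by linarith [hrel j])
      (by linarith)
  · exact fin q r c₂ c₃ c₁ hc₂ hc₃ hc₁ (fun j => by linarith [hrel j]) (by linarith)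
  · exact fin q q c₂ 0 (c₁ + c₃) hc₂ le_rfl (by positivity) (fun j => by linarith [hrel j])
      (by linarith)
  · exact fin r r c₃ 0 (c₁ + c₂) hc₃ le_rfl (by positivity) (fun j => by linarith [hrel j])
      (by linarith)
  · have h0 : (c₁ + c₂ + c₃) ^ 2 = 0 := norm_coeff_eq (e := fun _ => 0) he (by simp)
      (fun j => by linarith [hrel j])
    have : c₁ + c₂ + c₃ = 0 := pow_eq_zero_iff two_ne_zero |>.1 h0
    have : (c₁ + c₂ + c₃) * s < 0 := by linarith
    simp_all

/-- In every direction, the projections of the metric refinements at `x` and `y` are within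
distance `O(k ρ(x, y))`. -/
theorem CoordinateFreeCriterion.inner_le_inner_add (h : CoordinateFreeCriterion Hc l)
    {B' : ConvexBody Plane} (hB : (B : Set Plane) = ⋂ G ∈ Hc x, G.carrier)
    (hB' : (B' : Set Plane) = ⋂ G ∈ Hc y, G.carrier) (hk : 48 * l ≤ k) (hxy : edist x y ≠ ⊤)
    {e : Plane} (he : e 0 ^ 2 + e 1 ^ 2 = 1) {s t : ℝ}
    (hs : ∀ a ∈ refinement Hc k x 0, s < a 0 * e 0 + a 1 * e 1)
    (ht : ∀ b ∈ refinement Hc k y 0, b 0 * e 0 + b 1 * e 1 < t) :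
    s ≤ t + 9 / 2 * k * (edist x y).toReal := by
  have hl : 0 ≤ (l : ℝ) := l.2
  have hk0 : 0 ≤ k := le_trans (by positivity) hk
  have hnx : (refinement Hc k x 0).Nonempty := h.refinement_nonempty hB (by linarith)
  have hny : (refinement Hc k y 0).Nonempty := h.refinement_nonempty hB' (by linarith)
  have hδ : 0 ≤ (edist x y).toReal := ENNReal.toReal_nonneg
  obtain ⟨p₁, p₂, c₁, c₂, hc₁, hc₂, h₁₂, hs'⟩ := exists_dual hB hnx he hs
  obtain ⟨p₃, p₄, c₃, c₄, hc₃, hc₄, h₃₄, ht'⟩ := exists_dual hB' hny (e := fun j => -e j)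
    (s := -t) (by simpa using he) (fun b hb => by linarith [ht b hb])
  simp only [neg_neg] at h₃₄
  -- A point of one refinement violates a constraint of the other by at most τ = (3/2)kρ(x,y); since
  -- both refinements are nonempty, this gives the hypothesis `hT` of `gap_le`.
  have hxin : ∀ a ∈ refinement Hc k y 0, ∀ p : Constr Hc x,
      a 0 * p.1.2.normal 0 + a 1 * p.1.2.normal 1 ≤
        p.bound k + 3 / 2 * k * (edist x y).toReal := by
    intro a ha p
    have h1 := refinement_subset_of_edist hk0 hxy le_rfl ha p.1.1 p.1.2 p.2.1 p.2.2
    have h2 : k * (edist x y).toReal * p.1.2.mass ≤ k * (edist x y).toReal * (3 / 2) :=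
      mul_le_mul_of_nonneg_left (p.1.2.mass_le.trans sqrt_two_le) (by positivity)
    simp only [Constr.bound]
    linarith
  have hyin : ∀ a ∈ refinement Hc k x 0, ∀ p : Constr Hc y,
      a 0 * p.1.2.normal 0 + a 1 * p.1.2.normal 1 ≤
        p.bound k + 3 / 2 * k * (edist x y).toReal := by
    intro a ha p
    have h1 := refinement_subset_of_edist hk0 (edist_comm x y ▸ hxy) le_rfl ha p.1.1 p.1.2
      p.2.1 p.2.2
    have h2 : k * (edist y x).toReal * p.1.2.mass ≤ k * (edist y x).toReal * (3 / 2) :=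
      mul_le_mul_of_nonneg_left (p.1.2.mass_le.trans sqrt_two_le) (by positivity)
    rw [edist_comm x y]
    simp only [Constr.bound]
    linarith
  have key := gap_le (n := ![p₁.1.2.normal, p₂.1.2.normal, p₃.1.2.normal, p₄.1.2.normal])
    (β := ![p₁.bound k, p₂.bound k, p₃.bound k, p₄.bound k]) (c := ![c₁, c₂, c₃, c₄]) (e := e)
    (τ := 3 / 2 * k * (edist x y).toReal) (θ := 8 * l * (edist x y).toReal)
    (fun i => by
      fin_cases i
      · exact p₁.1.2.unit_normal
      · exact p₂.1.2.unit_normal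
      · exact p₃.1.2.unit_normal
      · exact p₄.1.2.unit_normal) (by positivity)
    (by
      have := mul_le_mul_of_nonneg_right hk hδ
      have : 0 ≤ l * (edist x y).toReal := by positivity
      linarith) he
    (fun c hc => by
      obtain ⟨hpos, hrel⟩ := hc
      simp only [Matrix.cons_val] at hrel
      simp only [gap, Matrix.cons_val]
      obtain ⟨a, ha⟩ := hnx
      obtain ⟨b, hb⟩ := hny
      constructor
      · have i1 := mul_le_mul_of_nonneg_left (hxin b hb p₁) (hpos 0)
        have i2 := mul_le_mul_of_nonneg_left (hxin b hb p₂) (hpos 1)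
        have i3 := mul_le_mul_of_nonneg_left
          (mem_halfSpace.1 (mem_refinement_zero.1 hb p₃)) (hpos 2)
        have i4 := mul_le_mul_of_nonneg_left
          (mem_halfSpace.1 (mem_refinement_zero.1 hb p₄)) (hpos 3)
        have j0 := congrArg (b 0 * ·) (hrel 0)
        have j1 := congrArg (b 1 * ·) (hrel 1)
        simp only [mul_zero] at j0 j1
        linarith
      · have i1 := mul_le_mul_of_nonneg_left
          (mem_halfSpace.1 (mem_refinement_zero.1 ha p₁)) (hpos 0)
        have i2 := mul_le_mul_of_nonneg_left
          (mem_halfSpace.1 (mem_refinement_zero.1 ha p₂)) (hpos 1)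
        have i3 := mul_le_mul_of_nonneg_left (hyin a ha p₃) (hpos 2)
        have i4 := mul_le_mul_of_nonneg_left (hyin a ha p₄) (hpos 3)
        have j0 := congrArg (a 0 * ·) (hrel 0)
        have j1 := congrArg (a 1 * ·) (hrel 1)
        simp only [mul_zero] at j0 j1
        linarith)
    (fun c v hc hv12 hv q₁ q₂ q₃ q₄ => by
      obtain ⟨hpos, hrel⟩ := hc
      simp only [Matrix.cons_val] at hrel hv12 q₁ q₂ q₃ q₄
      have h1 := h.offset_sum_le_of_pairs p₁.2.1 p₂.2.1 p₃.2.1 p₄.2.1 ENNReal.toReal_nonneg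
        ENNReal.toReal_nonneg ENNReal.toReal_nonneg ENNReal.toReal_nonneg hδ p₁.edist_le
        p₂.edist_le p₃.edist_le p₄.edist_le (ENNReal.ofReal_toReal hxy).ge (hpos 0) (hpos 1)
        (hpos 2) (hpos 3) hv12 (fun j => by linarith [hrel j, hv12 j]) hv q₁ q₂ q₃ q₄
      have aux : ∀ {x : M} (p : Constr Hc x) (c : ℝ), 0 ≤ c →
          48 * l * (c * (edist x p.1.1).toReal) ≤
            c * (k * (edist x p.1.1).toReal * p.1.2.mass) := by
        intro x p c hc
        have hr : 0 ≤ (edist x p.1.1).toReal := ENNReal.toReal_nonneg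
        have i1 : 48 * l * (c * (edist x p.1.1).toReal) ≤ k * (c * (edist x p.1.1).toReal) :=
          mul_le_mul_of_nonneg_right hk (by positivity)
        have i2 : c * k * (edist x p.1.1).toReal * 1 ≤
            c * k * (edist x p.1.1).toReal * p.1.2.mass :=
          mul_le_mul_of_nonneg_left p.1.2.one_le_mass (by positivity)
        linarith
      have a1 := aux p₁ (c 0) (hpos 0)
      have a2 := aux p₂ (c 1) (hpos 1)
      have a3 := aux p₃ (c 2) (hpos 2)
      have a4 := aux p₄ (c 3) (hpos 3)
      simp only [gap, Matrix.cons_val, Constr.bound]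
      linarith)
    ⟨fun i => by fin_cases i <;> simp [hc₁, hc₂, hc₃, hc₄], fun j => by
      simp only [Matrix.cons_val]
      linarith [h₁₂ j, h₃₄ j]⟩
    (fun j => by simpa only [Matrix.cons_val] using h₁₂ j)
  simp only [gap, Matrix.cons_val] at key
  linarith

end

/-! ### Nearest points in the uniform norm. -/

/-- A point lies in the rectangular hull of a set: in each coordinate the set has points on
both sides of it. -/
def InHull (S : Set Plane) (g : Plane) : Prop :=
  ∀ j, (∃ p ∈ S, p j ≤ g j) ∧ ∃ p ∈ S, g j ≤ p j

/-- The moves from a nearest point of a convex set towards another point of the set do not decrease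
the distance. -/
theorem exists_coord_of_nearest {S : Set Plane} (hS : Convex ℝ S) {f g p : Plane} (hf : f ∈ S)
    (hmin : ∀ a ∈ S, dist f g ≤ dist a g) (hd : 0 < dist f g) (hp : p ∈ S) :
    ∃ i, |f i - g i| = dist f g ∧ 0 ≤ (p i - f i) * (f i - g i) := by
  by_contra! hcon
  have hev : ∀ᶠ t in nhdsWithin (0 : ℝ) (Set.Ioi 0), ∀ i,
      |f i + t * (p i - f i) - g i| < dist f g := by
    rw [Filter.eventually_all]
    intro i
    rcases (abs_sub_apply_le f g i).lt_or_eq with hlt | heq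
    · refine Filter.Eventually.filter_mono nhdsWithin_le_nhds ?_
      have hcont : Continuous fun t : ℝ => |f i + t * (p i - f i) - g i| := by fun_prop
      exact hcont.continuousAt.eventually (gt_mem_nhds (by simpa using hlt))
    · have hneg := hcon i heq
      have hcont : Continuous fun t : ℝ => t * (p i - f i) ^ 2 := by fun_prop
      have h1 : ∀ᶠ t in nhdsWithin (0 : ℝ) (Set.Ioi 0),
          t * (p i - f i) ^ 2 < -2 * ((p i - f i) * (f i - g i)) :=
        (hcont.continuousAt.eventually (gt_mem_nhds (by simp only [zero_mul]; linarith))).filter_mono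
          nhdsWithin_le_nhds
      filter_upwards [h1, self_mem_nhdsWithin] with t ht ht0
      rw [← heq, ← sq_lt_sq]
      have := mul_lt_mul_of_pos_left ht (Set.mem_Ioi.1 ht0)
      nlinarith
  obtain ⟨t, ht, ht0, ht1⟩ := (hev.and (Filter.Eventually.and
    (self_mem_nhdsWithin (a := (0 : ℝ)) (s := Set.Ioi 0))
    ((gt_mem_nhds one_pos).filter_mono nhdsWithin_le_nhds))).exists
  have hmem := hS.add_smul_sub_mem hf hp ⟨(Set.mem_Ioi.1 ht0).le, le_of_lt ht1⟩
  have hlt : dist (f + t • (p - f)) g < dist f g := by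
    rw [dist_pi_lt_iff hd]
    intro i
    rw [Real.dist_eq]
    simpa using ht i
  exact absurd (hmin _ hmem) (not_le.2 hlt)

/-- The nearest point to a point of the rectangular hull is a corner of a square. -/
theorem abs_sub_eq_dist_of_nearest {S : Set Plane} (hS : Convex ℝ S) {f g : Plane} (hf : f ∈ S)
    (hmin : ∀ a ∈ S, dist f g ≤ dist a g) (hg : InHull S g) (i : Fin 2) :
    |f i - g i| = dist f g := by
  rcases (dist_nonneg (x := f) (y := g)).eq_or_lt with h0 | hd
  · exact le_antisymm (abs_sub_apply_le f g i) (h0 ▸ abs_nonneg _)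
  obtain ⟨j, hj⟩ : ∃ j, ∀ m, m = i ∨ m = j := ⟨1 - i, fun m => by
    fin_cases i <;> fin_cases m <;> simp⟩
  -- Moving towards this p brings coordinate j closer to g unless it already agrees, so the
  -- obstruction to getting nearer must be coordinate i.
  obtain ⟨p, hp, hpj⟩ : ∃ p ∈ S, f j - g j ≠ 0 → (p j - f j) * (f j - g j) < 0 := by
    rcases lt_trichotomy (f j - g j) 0 with h | h | h
    · obtain ⟨p, hp, hpj⟩ := (hg j).2
      exact ⟨p, hp, fun _ => mul_neg_of_pos_of_neg (by linarith) h⟩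
    · exact ⟨f, hf, fun h' => absurd h h'⟩
    · obtain ⟨p, hp, hpj⟩ := (hg j).1
      exact ⟨p, hp, fun _ => mul_neg_of_neg_of_pos (by linarith) h⟩
  obtain ⟨m, hm, hm'⟩ := exists_coord_of_nearest hS hf hmin hd hp
  rcases hj m with rfl | rfl
  · exact hm
  · have : f m - g m ≠ 0 := fun h => by rw [h, abs_zero] at hm; linarith
    exact absurd hm' (not_le.2 (hpj this))

/-- The points of the set at the height of `g` lie beyond the nearest point. -/
theorem exists_mem_beyond_nearest {S : Set Plane} (hS : Convex ℝ S) {f g : Plane} (hf : f ∈ S)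
    (hmin : ∀ a ∈ S, dist f g ≤ dist a g) (hd : 0 < dist f g) (hg : InHull S g) {i j : Fin 2}
    (hij : ∀ m, m = i ∨ m = j) :
    ∃ a ∈ S, a j = g j ∧ 0 ≤ (a i - f i) * (f i - g i) := by
  have hj := abs_sub_eq_dist_of_nearest hS hf hmin hg j
  have hj0 : f j - g j ≠ 0 := fun h => by rw [h, abs_zero] at hj; linarith
  obtain ⟨p, hp, t, ht, hpt, hpj⟩ : ∃ p ∈ S, ∃ t ∈ Set.Icc (0 : ℝ) 1,
      f j + t * (p j - f j) = g j ∧ (p j - f j) * (f j - g j) < 0 := by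
    rcases lt_or_gt_of_ne hj0 with h | h
    · obtain ⟨p, hp, hpj⟩ := (hg j).2
      have hpos : 0 < p j - f j := by linarith
      refine ⟨p, hp, (g j - f j) / (p j - f j), ⟨div_nonneg (by linarith) hpos.le,
        (div_le_one hpos).2 (by linarith)⟩, ?_, mul_neg_of_pos_of_neg hpos h⟩
      field_simp
      ring
    · obtain ⟨p, hp, hpj⟩ := (hg j).1
      have hpos : 0 < f j - p j := by linarith
      refine ⟨p, hp, (f j - g j) / (f j - p j), ⟨div_nonneg (by linarith) hpos.le,
        (div_le_one hpos).2 (by linarith)⟩, ?_, mul_neg_of_neg_of_pos (by linarith) h⟩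
      field_simp
      ring
  obtain ⟨m, hm, hm'⟩ := exists_coord_of_nearest hS hf hmin hd hp
  refine ⟨f + t • (p - f), hS.add_smul_sub_mem hf hp ht, by simpa using hpt, ?_⟩
  rcases hij m with rfl | rfl
  · have : (f + t • (p - f)) m - f m = t * (p m - f m) := by simp
    rw [this, mul_assoc]
    exact mul_nonneg ht.1 hm'
  · exact absurd hm' (not_le.2 hpj)

/-- Stability of the nearest points for two convex sets the convex hull of which is, up to `δ`,
not nearer than the sets themselves. -/
theorem dist_nearest_le {S T : Set Plane} (hS : Convex ℝ S) (hT : Convex ℝ T) {f g f' g' : Plane}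
    (hf : f ∈ S) (hf' : f' ∈ T) (hmin : ∀ a ∈ S, dist f g ≤ dist a g)
    (hmin' : ∀ a ∈ T, dist f' g' ≤ dist a g') (hg : InHull S g) (hg' : InHull T g') {η δ : ℝ}
    (hη : dist g g' ≤ η) (hδ : 0 ≤ δ)
    (hN : ∀ a ∈ S, ∀ a' ∈ T, ∀ b ∈ segment ℝ a a', dist f g ≤ dist b g + δ)
    (hN' : ∀ a ∈ S, ∀ a' ∈ T, ∀ b ∈ segment ℝ a a', dist f' g' ≤ dist b g' + δ) :
    dist f f' ≤ 6 * η + 3 * δ := by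
  have hη0 : 0 ≤ η := dist_nonneg.trans hη
  have h1 : dist f g ≤ dist f' g' + η + δ := by
    have := hN f hf f' hf' f' (right_mem_segment ℝ f f')
    have := dist_triangle_right f' g g'
    linarith
  have h2 : dist f' g' ≤ dist f g + η + δ := by
    have := hN' f hf f' hf' f (left_mem_segment ℝ f f')
    have := dist_triangle f g g'
    linarith
  rcases le_or_gt (dist f g) (2 * η + δ) with hsmall | hbig
  · have := dist_triangle4 f g g' f'
    rw [dist_comm g' f'] at this
    linarith
  have hd : 0 < dist f g := by linarith
  have hd' : 0 < dist f' g' := by linarith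
  have coord : ∀ i j : Fin 2, (∀ m, m = i ∨ m = j) → |f i - f' i| ≤ 2 * η + δ := by
    intro i j hij
    have e := abs_sub_eq_dist_of_nearest hS hf hmin hg i
    have e' := abs_sub_eq_dist_of_nearest hT hf' hmin' hg' i
    have hgi := (abs_sub_apply_le g g' i).trans hη
    have hgj := (abs_sub_apply_le g g' j).trans hη
    obtain ⟨a, ha, haj, hai⟩ := exists_mem_beyond_nearest hS hf hmin hd hg hij
    obtain ⟨a', ha', haj', hai'⟩ := exists_mem_beyond_nearest hT hf' hmin' hd' hg' hij
    -- A point of the segment [a, a'] with i-th coordinate g i is within η of g, which contradicts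
    -- dist f g > 2η + δ. If the signs of f i - g i and f' i - g' i differed, a and a' would lie on
    -- opposite sides of g i and such a point would exist.
    have cross : ∀ t : ℝ, 0 ≤ t → t ≤ 1 → a i + t * (a' i - a i) = g i → False := by
      intro t ht0 ht1 ht
      have hb := hN a ha a' ha' (a + t • (a' - a)) (by
        rw [segment_eq_image']
        exact ⟨t, ⟨ht0, ht1⟩, rfl⟩)
      have hbg : dist (a + t • (a' - a)) g ≤ η := by
        have hi : |(a + t • (a' - a)) i - g i| ≤ η := by
          rw [show (a + t • (a' - a)) i = g i by simpa using ht, sub_self, abs_zero]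
          exact hη0
        have hj : |(a + t • (a' - a)) j - g j| ≤ η := by
          have : (a + t • (a' - a)) j - g j = -(t * (g j - g' j)) := by
            simp [haj, haj']; ring
          rw [this, abs_neg, abs_mul, abs_of_nonneg ht0]
          exact (mul_le_of_le_one_left (abs_nonneg _) ht1).trans hgj
        have hall : ∀ m, |(a + t • (a' - a)) m - g m| ≤ η := fun m => by
          rcases hij m with rfl | rfl
          exacts [hi, hj]
        exact dist_plane_le (hall 0) (hall 1)
      linarith
    rw [abs_le] at hgi
    rcases eq_or_eq_neg_of_abs_eq e with s | s <;> rcases eq_or_eq_neg_of_abs_eq e' with s' | s'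
    · rw [abs_le]; constructor <;> linarith
    · exfalso
      rw [s] at hai
      rw [s'] at hai'
      have i1 : 0 ≤ a i - f i := nonneg_of_mul_nonneg_left hai hd
      have i2 : a' i - f' i ≤ 0 := by
        by_contra! hcon
        have := mul_pos hcon hd'
        linarith
      have hpos : 0 < a i - a' i := by linarith
      refine cross ((a i - g i) / (a i - a' i)) (div_nonneg (by linarith) hpos.le)
        ((div_le_one hpos).2 (by linarith)) ?_
      field_simp
      ring
    · exfalso
      rw [s] at hai
      rw [s'] at hai'
      have i1 : 0 ≤ a' i - f' i := nonneg_of_mul_nonneg_left hai' hd'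
      have i2 : a i - f i ≤ 0 := by
        by_contra! hcon
        have := mul_pos hcon hd
        linarith
      have hpos : 0 < a' i - a i := by linarith
      refine cross ((g i - a i) / (a' i - a i)) (div_nonneg (by linarith) hpos.le)
        ((div_le_one hpos).2 (by linarith)) ?_
      field_simp
      ring
    · rw [abs_le]; constructor <;> linarith
  have h0 := coord 0 1 (fun m => by fin_cases m <;> simp)
  have h1' := coord 1 0 (fun m => by fin_cases m <;> simp)
  exact (dist_plane_le h0 h1').trans (by linarith)

/-! ### Construction of the selection. -/

/-- Selections of interval-valued mappings. -/
theorem exists_interval_selection (lo hi : M → ℝ) {L : ℝ} (hL : 0 ≤ L)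
    (h : ∀ x y, edist x y ≠ ⊤ → lo x ≤ hi y + L * (edist x y).toReal) :
    ∃ g : M → ℝ, (∀ x, lo x ≤ g x ∧ g x ≤ hi x) ∧
      ∀ x y, edist x y ≠ ⊤ → |g x - g y| ≤ L * (edist x y).toReal := by
  have hbdd : ∀ x, BddBelow (Set.range fun y : {y // edist x y ≠ ⊤} =>
      hi y + L * (edist x y.1).toReal) := fun x => ⟨lo x, by
    rintro _ ⟨y, rfl⟩
    exact h x y y.2⟩
  have hne : ∀ x : M, Nonempty {y // edist x y ≠ ⊤} := fun x => ⟨⟨x, by simp⟩⟩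
  -- McShane's formula, restricted to finite distances so that every term is real.
  set g : M → ℝ := fun x => ⨅ y : {y // edist x y ≠ ⊤}, (hi y + L * (edist x y.1).toReal) with hg
  have hle : ∀ x y, edist x y ≠ ⊤ → g x ≤ g y + L * (edist x y).toReal := by
    intro x y hxy
    rw [← sub_le_iff_le_add]
    have := hne y
    refine le_ciInf fun z => ?_
    have hxz : edist x z.1 ≠ ⊤ :=
      ne_top_of_le_ne_top (ENNReal.add_ne_top.2 ⟨hxy, z.2⟩) (edist_triangle x y z)
    have h1 : g x ≤ hi z + L * (edist x z.1).toReal := ciInf_le (hbdd x) ⟨z.1, hxz⟩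
    have h2 : (edist x z.1).toReal ≤ (edist x y).toReal + (edist y z.1).toReal := by
      rw [← ENNReal.toReal_add hxy z.2]
      exact ENNReal.toReal_mono (ENNReal.add_ne_top.2 ⟨hxy, z.2⟩) (edist_triangle x y z)
    have := mul_le_mul_of_nonneg_left h2 hL
    linarith
  refine ⟨g, fun x => ⟨?_, ?_⟩, fun x y hxy => ?_⟩
  · have := hne x
    exact le_ciInf fun y => h x y y.2
  · have := ciInf_le (hbdd x) ⟨x, by simp⟩
    simpa using this
  · have h1 := hle x y hxy
    have h2 := hle y x (edist_comm x y ▸ hxy)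
    rw [edist_comm y x] at h2
    rw [abs_le]
    constructor <;> linarith

/-- The points of a metric refinement are about as near to a point of its rectangular hull as the
points of the relaxed refinement. -/
theorem exists_mem_refinement_dist_le {Hc : M → Set HalfPlane} {k : ℝ} {x : M} {δ : ℝ}
    {B : ConvexBody Plane} (hB : (B : Set Plane) = ⋂ G ∈ Hc x, G.carrier) {g a : Plane}
    (hg : InHull (refinement Hc k x 0) g) (hδ : 0 ≤ δ) (ha : a ∈ refinement Hc k x δ) :
    ∃ f ∈ refinement Hc k x 0, dist f g ≤ dist a g + δ := by
  set r := dist a g + δ with hr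
  have hr0 : 0 ≤ r := by positivity
  let n : Fin 2 × Bool → Plane := fun i => Pi.single i.1 (if i.2 then 1 else -1)
  let β : Fin 2 × Bool → ℝ := fun i => (if i.2 then 1 else -1) * g i.1 + r
  have hmem : ∀ (b : Plane) (i : Fin 2 × Bool), b ∈ halfSpace (n i) (β i) ↔
      (if i.2 then 1 else -1) * (b i.1 - g i.1) ≤ r := by
    rintro b ⟨j, s⟩
    rw [mem_halfSpace]
    revert j
    rw [Fin.forall_fin_two]
    constructor <;> cases s <;> simp only [n, β, Pi.single_apply] <;> simp <;>
      constructor <;> intro h <;> linarith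
  have hsq : ∀ b : Plane, (∀ j, |b j - g j| ≤ r) → ∀ i, b ∈ halfSpace (n i) (β i) := by
    rintro b hb ⟨j, s⟩
    rw [hmem]
    have := abs_le.1 (hb j)
    cases s <;> simp <;> linarith
  -- a point of the square in a given half-plane
  have one : ∀ p : Constr Hc x, ∃ b, b ∈ halfSpace p.1.2.normal (p.bound k) ∧
      ∀ i, b ∈ halfSpace (n i) (β i) := by
    intro p
    let σ : Fin 2 → ℝ := fun j => if 0 ≤ p.1.2.normal j then 1 else -1
    have hσ : ∀ j, σ j * p.1.2.normal j = |p.1.2.normal j| := by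
      intro j
      simp only [σ]
      split_ifs with h
      · rw [one_mul, abs_of_nonneg h]
      · rw [neg_one_mul, abs_of_neg (not_le.1 h)]
    have hσ1 : ∀ j, |σ j| = 1 := by
      intro j
      simp only [σ]
      split_ifs <;> simp
    -- The corner shift by δ in the direction -σ lowers the linear form by δ times the mass of the
    -- half-plane, exactly the relaxation that a enjoys.
    refine ⟨fun j => a j - δ * σ j, ?_, hsq _ fun j => ?_⟩
    · have h1 := ha p.1.1 p.1.2 p.2.1 p.2.2
      rw [mem_halfSpace, Constr.bound]
      have h0 := hσ 0
      have h2 := hσ 1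
      have h3 : p.1.2.mass = σ 0 * p.1.2.normal 0 + σ 1 * p.1.2.normal 1 := by
        rw [h0, h2]; rfl
      have h4 : δ * p.1.2.mass = δ * (σ 0 * p.1.2.normal 0 + σ 1 * p.1.2.normal 1) := by rw [h3]
      linarith
    · have h1 := abs_sub_apply_le a g j
      have h2 := abs_sub (a j - g j) (δ * σ j)
      rw [abs_mul, hσ1, abs_of_nonneg hδ, mul_one] at h2
      rw [sub_right_comm]
      linarith
  obtain ⟨p₀, hp₀, -⟩ := (hg 0).1
  have two : ∀ i : Fin 2 × Bool, ∃ b ∈ refinement Hc k x 0, b ∈ halfSpace (n i) (β i) := by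
    rintro ⟨j, s⟩
    cases s
    · obtain ⟨p, hp, hpj⟩ := (hg j).2
      refine ⟨p, hp, (hmem _ _).2 ?_⟩
      simp
      linarith
    · obtain ⟨p, hp, hpj⟩ := (hg j).1
      refine ⟨p, hp, (hmem _ _).2 ?_⟩
      simp
      linarith
  have zero : ∃ b, ∀ i, b ∈ halfSpace (n i) (β i) :=
    ⟨g, hsq g fun j => by simpa using hr0⟩
  -- Helly for the refinement and the four sides of the square of radius r about g. Witnesses for a
  -- triple: any point of the refinement for no side, a hull point for one side, the shifted a for
  -- two, and g for three.
  obtain ⟨f, hf, hfs⟩ := exists_mem_refinement (k := k) hB n β (by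
    rintro (p | i) (q | j) (t | m) <;> simp only [Sum.elim_inl, Sum.elim_inr]
    · exact ⟨p₀, mem_refinement_zero.1 hp₀ p, mem_refinement_zero.1 hp₀ q,
        mem_refinement_zero.1 hp₀ t⟩
    · obtain ⟨b, hb, hb'⟩ := two m
      exact ⟨b, mem_refinement_zero.1 hb p, mem_refinement_zero.1 hb q, hb'⟩
    · obtain ⟨b, hb, hb'⟩ := two j
      exact ⟨b, mem_refinement_zero.1 hb p, hb', mem_refinement_zero.1 hb t⟩
    · obtain ⟨b, hb, hb'⟩ := one p
      exact ⟨b, hb, hb' j, hb' m⟩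
    · obtain ⟨b, hb, hb'⟩ := two i
      exact ⟨b, hb', mem_refinement_zero.1 hb q, mem_refinement_zero.1 hb t⟩
    · obtain ⟨b, hb, hb'⟩ := one q
      exact ⟨b, hb' i, hb, hb' m⟩
    · obtain ⟨b, hb, hb'⟩ := one t
      exact ⟨b, hb' i, hb' j, hb⟩
    · obtain ⟨b, hb'⟩ := zero
      exact ⟨b, hb' i, hb' j, hb' m⟩)
  refine ⟨f, hf, ?_⟩
  have hall : ∀ j, |f j - g j| ≤ r := by
    intro j
    have h1 := (hmem f (j, true)).1 (hfs _)
    have h2 := (hmem f (j, false)).1 (hfs _)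
    simp at h1 h2
    rw [abs_le]
    constructor <;> linarith
  exact dist_plane_le (hall 0) (hall 1)

/-- The criterion is sufficient for the existence of a Lipschitz selection. -/
theorem CoordinateFreeCriterion.exists_selection {F : M → ConvexBody Plane}
    {Hc : M → Set HalfPlane} (hF : ∀ x, (F x : Set Plane) = ⋂ G ∈ Hc x, G.carrier) {l : ℝ≥0}
    (hl : 0 < l) (h : CoordinateFreeCriterion Hc l) :
    ∃ f : M → Plane, (∀ x, f x ∈ (F x : Set Plane)) ∧ LipschitzWith (1440 * l) f := by
  set k : ℝ := 48 * l with hk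
  have hl0 : 0 ≤ (l : ℝ) := l.2
  have hk0 : 0 ≤ k := by positivity
  have hc : ∀ x, IsCompact (refinement Hc k x 0) := fun x => isCompact_refinement (hF x)
  have hne : ∀ x, (refinement Hc k x 0).Nonempty := fun x =>
    h.refinement_nonempty (hF x) (by linarith)
  have hbot : ∀ (j : Fin 2) (x : M), ∃ p ∈ refinement Hc k x 0,
      ∀ a ∈ refinement Hc k x 0, p j ≤ a j := fun j x =>
    (hc x).exists_isMinOn (hne x) (continuous_apply j).continuousOn
  have htop : ∀ (j : Fin 2) (x : M), ∃ p ∈ refinement Hc k x 0,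
      ∀ a ∈ refinement Hc k x 0, a j ≤ p j := fun j x =>
    (hc x).exists_isMaxOn (hne x) (continuous_apply j).continuousOn
  choose bot hbotm hbot using hbot
  choose top htopm htop using htop
  have hgap : ∀ j x y, edist x y ≠ ⊤ →
      bot j x j ≤ top j y j + 9 / 2 * k * (edist x y).toReal := by
    intro j x y hxy
    apply le_of_forall_pos_le_add
    intro ε hε
    have hdot : ∀ a : Plane, a 0 * (Pi.single j 1 : Plane) 0 + a 1 * (Pi.single j 1 : Plane) 1 =
        a j := by
      intro a
      revert j
      rw [Fin.forall_fin_two]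
      simp
    have := h.inner_le_inner_add (hF x) (hF y) le_rfl hxy (e := Pi.single j 1)
      (s := bot j x j - ε / 2) (t := top j y j + ε / 2)
      (by rw [sq, sq, hdot, Pi.single_eq_same])
      (fun a ha => by rw [hdot]; linarith [hbot j x a ha])
      (fun a ha => by rw [hdot]; linarith [htop j y a ha])
    linarith
  choose g hgmem hglip using fun j => exists_interval_selection (fun x => bot j x j)
    (fun x => top j x j) (by positivity : 0 ≤ 9 / 2 * k) (hgap j)
  have hhull : ∀ x, InHull (refinement Hc k x 0) (fun j => g j x) := fun x j =>
    ⟨⟨_, hbotm j x, (hgmem j x).1⟩, ⟨_, htopm j x, (hgmem j x).2⟩⟩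
  have hnear : ∀ x, ∃ f ∈ refinement Hc k x 0, ∀ a ∈ refinement Hc k x 0,
      dist f (fun j => g j x) ≤ dist a (fun j => g j x) := fun x =>
    (hc x).exists_isMinOn (f := fun a => dist a fun j => g j x) (hne x) (by fun_prop)
  choose f hfm hfmin using hnear
  refine ⟨f, fun x => refinement_subset (hF x) (hfm x), fun x y => ?_⟩
  by_cases hxy : edist x y = ⊤
  -- Positivity of `l` matters here, since 0 · ∞ = 0.
  · rw [hxy, ENNReal.mul_top (by simpa using hl.ne')]
    exact le_top
  have hyx : edist y x ≠ ⊤ := edist_comm x y ▸ hxy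
  have hδ : 0 ≤ k * (edist x y).toReal := by positivity
  have hd : dist (f x) (f y) ≤ 1440 * l * (edist x y).toReal := by
    -- With η = (9/2)kρ and δ = kρ the bound 6η + 3δ is 30kρ = 1440`l`ρ. Both refinements lie in the
    -- convex relaxed refinement at x, hence so do the segments between them; the same holds at y.
    refine (dist_nearest_le convex_refinement convex_refinement (hfm x) (hfm y) (hfmin x)
      (hfmin y) (hhull x) (hhull y) (dist_plane_le (hglip 0 x y hxy) (hglip 1 x y hxy)) hδ
      ?_ ?_).trans (by rw [hk]; linarith)
    · intro a ha a' ha' b hb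
      have hb' := convex_refinement.segment_subset (refinement_mono hδ ha)
        (refinement_subset_of_edist hk0 hxy le_rfl ha') hb
      obtain ⟨c, hc, hcb⟩ := exists_mem_refinement_dist_le (hF x) (hhull x) hδ hb'
      exact (hfmin x c hc).trans hcb
    · intro a ha a' ha' b hb
      have hb' := convex_refinement.segment_subset
        (refinement_subset_of_edist hk0 hyx (by rw [edist_comm]) ha)
        (refinement_mono hδ ha') hb
      obtain ⟨c, hc, hcb⟩ := exists_mem_refinement_dist_le (hF y) (hhull y) hδ hb'
      exact (hfmin y c hc).trans hcb
  rw [edist_dist, ← ENNReal.ofReal_toReal hxy, ← ENNReal.ofReal_coe_nnreal,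
    ← ENNReal.ofReal_mul (NNReal.coe_nonneg _)]
  exact ENNReal.ofReal_le_ofReal (by simpa using hd)

/-! ### Necessity of the criterion. -/

theorem setDist_le_edist {A B : Set Plane} {p q : Plane} (hp : p ∈ A) (hq : q ∈ B) :
    setDist A B ≤ edist p q := by
  rw [setDist, if_pos ⟨⟨p, hp⟩, ⟨q, hq⟩⟩]
  exact (iInf₂_le p hp).trans (iInf₂_le q hq)

/-- A selection stays near the intersections of two half-planes. -/
theorem exists_mem_inter_edist_le {f : M → Plane} {K : ℝ≥0} (hf : LipschitzWith K f) {x x' : M}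
    {G G' : HalfPlane} (hx : f x ∈ G.carrier) (hx' : f x' ∈ G'.carrier)
    (hfin : edist x x' / ENNReal.ofReal |G.cross G'| ≠ ⊤) :
    ∃ p ∈ G.carrier ∩ G'.carrier,
      edist (f x) p ≤ (NNReal.sqrt 2 * K : ℝ≥0) * (edist x x' / ENNReal.ofReal |G.cross G'|) := by
  by_cases h0 : edist x x' = 0
  · have h1 : edist (f x) (f x') ≤ 0 := by simpa [h0] using hf x x'
    have h2 : f x = f x' := edist_le_zero.1 h1
    exact ⟨f x, ⟨hx, h2 ▸ hx'⟩, by simp⟩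
  have hcross : G.cross G' ≠ 0 := fun hc => by
    rw [hc, abs_zero, ENNReal.ofReal_zero, ENNReal.div_zero h0] at hfin
    exact hfin rfl
  have htop : edist x x' ≠ ⊤ := fun ht => by
    rw [ht, ENNReal.top_div_of_ne_top ENNReal.ofReal_ne_top] at hfin
    exact hfin rfl
  set d := (edist x x').toReal with hd
  have hd0 : 0 ≤ d := ENNReal.toReal_nonneg
  have hdist : dist (f x) (f x') ≤ K * d := by
    have h1 := hf x x'
    rw [edist_dist, ← ENNReal.ofReal_toReal htop, ← ENNReal.ofReal_coe_nnreal,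
      ← ENNReal.ofReal_mul (NNReal.coe_nonneg _)] at h1
    exact (ENNReal.ofReal_le_ofReal_iff (by positivity)).1 h1
  rw [HalfPlane.mem_carrier] at hx hx'
  have hviol : f x 0 * G'.normal 0 + f x 1 * G'.normal 1 + G'.offset ≤ √2 * (K * d) := by
    have := inner_le_of_abs_le (u := fun i => f x i - f x' i) (w := G'.normal)
      (fun i => (abs_sub_apply_le _ _ i).trans hdist) G'.mass_le
    linarith
  -- Moving along the boundary direction of G keeps the inequality for G and changes that for G' at
  -- the rate `G.cross G'`; this t compensates the largest possible violation √2 K d.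
  set t := -(√2 * (K * d)) / G.cross G' with ht
  have htc : t * G.cross G' = -(√2 * (K * d)) := by rw [ht]; field_simp
  have habs : |t| = √2 * K * (d / |G.cross G'|) := by
    rw [ht, abs_div, abs_neg, abs_of_nonneg (by positivity)]; ring
  refine ⟨![f x 0 - t * G.normal 1, f x 1 + t * G.normal 0], ⟨?_, ?_⟩, ?_⟩
  · rw [HalfPlane.mem_carrier]
    simp only [Matrix.cons_val_zero, Matrix.cons_val_one]
    linarith
  · rw [HalfPlane.mem_carrier]
    simp only [Matrix.cons_val_zero, Matrix.cons_val_one]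
    unfold HalfPlane.cross at htc
    linarith
  · rw [edist_dist, ← ENNReal.ofReal_toReal htop, ← ENNReal.ofReal_div_of_pos (abs_pos.2 hcross),
      ← ENNReal.ofReal_coe_nnreal, ← ENNReal.ofReal_mul (NNReal.coe_nonneg _)]
    apply ENNReal.ofReal_le_ofReal
    rw [NNReal.coe_mul, Real.coe_sqrt, NNReal.coe_ofNat, ← hd, ← habs]
    apply dist_plane_le
    · simp only [Matrix.cons_val_zero, sub_sub_cancel, abs_mul]
      exact mul_le_of_le_one_right (abs_nonneg _) (G.abs_normal_le 1)
    · simp only [Matrix.cons_val_one, Matrix.cons_val_zero, sub_add_cancel_left, abs_neg,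
        abs_mul]
      exact mul_le_of_le_one_right (abs_nonneg _) (G.abs_normal_le 0)

/-- The criterion is necessary for the existence of a Lipschitz selection. -/
theorem coordinateFreeCriterion_of_selection {F : M → ConvexBody Plane} {Hc : M → Set HalfPlane}
    (hF : ∀ x, (F x : Set Plane) = ⋂ G ∈ Hc x, G.carrier) {f : M → Plane}
    (hmem : ∀ x, f x ∈ (F x : Set Plane)) {K : ℝ≥0} (hK : 0 < K) (hf : LipschitzWith K f) :
    CoordinateFreeCriterion Hc (NNReal.sqrt 2 * K) := by
  intro x x' y y' G₁ m₁ G₂ m₂ G₃ m₃ G₄ m₄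
  rw [HalfPlane.sin_boundaryAngle, HalfPlane.sin_boundaryAngle]
  have hin : ∀ x, ∀ G ∈ Hc x, f x ∈ G.carrier := fun x G hG => by
    have := hmem x
    rw [hF x] at this
    exact Set.mem_iInter₂.1 this G hG
  have hne : ((NNReal.sqrt 2 * K : ℝ≥0) : ℝ≥0∞) ≠ 0 := by
    rw [ENNReal.coe_ne_zero]
    exact (mul_pos (NNReal.sqrt_pos.2 two_pos) hK).ne'
  by_cases h₁ : edist x x' / ENNReal.ofReal |G₁.cross G₂| = ⊤
  · rw [h₁, top_add, top_add, ENNReal.mul_top hne]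
    exact le_top
  by_cases h₂ : edist y y' / ENNReal.ofReal |G₃.cross G₄| = ⊤
  · rw [h₂, add_top, top_add, ENNReal.mul_top hne]
    exact le_top
  obtain ⟨p, hp, hp'⟩ := exists_mem_inter_edist_le hf (hin x G₁ m₁) (hin x' G₂ m₂) h₁
  obtain ⟨q, hq, hq'⟩ := exists_mem_inter_edist_le hf (hin y G₃ m₃) (hin y' G₄ m₄) h₂
  have h3 : edist (f x) (f y) ≤ (NNReal.sqrt 2 * K : ℝ≥0) * Metric.ediam {x, x', y, y'} := by
    refine (hf x y).trans (mul_le_mul' ?_ (Metric.edist_le_ediam_of_mem (by simp) (by simp)))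
    rw [ENNReal.coe_le_coe]
    exact le_mul_of_one_le_left' (NNReal.one_le_sqrt.2 one_le_two)
  calc setDist (G₁.carrier ∩ G₂.carrier) (G₃.carrier ∩ G₄.carrier) ≤ edist p q :=
        setDist_le_edist hp hq
    _ ≤ edist p (f x) + edist (f x) (f y) + edist (f y) q := edist_triangle4 _ _ _ _
    _ ≤ _ := by
      rw [mul_add, mul_add, edist_comm p, add_right_comm]
      gcongr

/-! ### The two-sided bound and the theorem. -/

theorem criterionConst_le {F : M → ConvexBody Plane} {Hc : M → Set HalfPlane}
    (hF : ∀ x, (F x : Set Plane) = ⋂ G ∈ Hc x, G.carrier) :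
    ENNReal.ofReal (1 / √2) * criterionConst Hc ≤ selectionNorm F := by
  refine le_iInf₂ fun f hf => le_iInf fun K => le_iInf₂ fun hK hfK => ?_
  have hcrit := coordinateFreeCriterion_of_selection hF hf.1 hK hfK
  have hpos : 0 < NNReal.sqrt 2 * K := mul_pos (NNReal.sqrt_pos.2 two_pos) hK
  have h1 : criterionConst Hc ≤ (NNReal.sqrt 2 * K : ℝ≥0) :=
    (iInf_le _ _).trans (iInf₂_le hpos hcrit)
  refine (mul_le_mul_right h1 _).trans (le_of_eq ?_)
  rw [← ENNReal.ofReal_coe_nnreal, ← ENNReal.ofReal_mul (by positivity),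
    ← ENNReal.ofReal_coe_nnreal (p := K)]
  congr 1
  rw [NNReal.coe_mul, Real.coe_sqrt, NNReal.coe_ofNat]
  field_simp

theorem selectionNorm_le {F : M → ConvexBody Plane} {Hc : M → Set HalfPlane}
    (hF : ∀ x, (F x : Set Plane) = ⋂ G ∈ Hc x, G.carrier) :
    selectionNorm F ≤ ((1440 : ℝ≥0) : ℝ≥0∞) * criterionConst Hc := by
  rw [mul_comm, ← ENNReal.div_le_iff_le_mul (Or.inl (by simp)) (Or.inl ENNReal.coe_ne_top)]
  refine le_iInf fun l => le_iInf₂ fun hl h => ?_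
  rw [ENNReal.div_le_iff_le_mul (Or.inl (by simp)) (Or.inl ENNReal.coe_ne_top),
    mul_comm, ← ENNReal.coe_mul]
  obtain ⟨f, hmem, hf⟩ := h.exists_selection hF hl
  exact (iInf₂_le f ⟨hmem, _, hf⟩).trans
    ((iInf_le _ (1440 * l)).trans (iInf₂_le (by positivity) hf))

end LipSel

end

theorem mainTheorem11 :
    ∃ γ : ℝ≥0, 0 < γ ∧
      ∀ (M : Type*) [PseudoEMetricSpace M] (F : M → ConvexBody LipSel.Plane)
        (Hc : M → Set LipSel.HalfPlane),
        (∀ x, (F x : Set LipSel.Plane) = ⋂ G ∈ Hc x, G.carrier) →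
        ((∃ f : M → LipSel.Plane, LipSel.IsLipschitzSelection F f) ↔
            ∃ l : ℝ≥0, 0 < l ∧ LipSel.CoordinateFreeCriterion Hc l) ∧
          ENNReal.ofReal (1 / √2) * LipSel.criterionConst Hc ≤ LipSel.selectionNorm F ∧
          LipSel.selectionNorm F ≤ (γ : ℝ≥0∞) * LipSel.criterionConst Hc := by
  refine ⟨1440, by positivity, fun M _ F Hc hF => ⟨⟨?_, ?_⟩, LipSel.criterionConst_le hF,
    LipSel.selectionNorm_le hF⟩⟩
  · rintro ⟨f, hmem, K, hK⟩
    -- The given constant may be 0, while the criterion asks for a positive one.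
    have hpos : 0 < K + 1 := by positivity
    exact ⟨_, mul_pos (NNReal.sqrt_pos.2 two_pos) hpos,
      LipSel.coordinateFreeCriterion_of_selection hF hmem hpos (hK.weaken (by simp))⟩
  · rintro ⟨l, hl, h⟩
    obtain ⟨f, hmem, hf⟩ := h.exists_selection hF hl
    exact ⟨f, hmem, _, hf⟩
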